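/- Let $A$ be a finite alphabet. A class $\mathcal{C}$ of languages over $A$ is a *prevariety* if it consists of regular languages, contains $\emptyset$ and $A^*$, and is closed under union, intersection, complement, and the quotients $L \mapsto u^{-1}L$, $L \mapsto Lu^{-1}$ for all $u \in A^*$. Its unambiguous polynomial closure $\mathrm{UPol}(\mathcal{C})$ is the least class of languages that contains $\mathcal{C}$ and is closed under disjoint union and under unambiguous marked concatenation: $KaL$ with $a \in A$ belongs to the class whenever $K$ and $L$ do and every $w \in KaL$ has a unique decomposition $w = uav$ with $u \in K$, $v \in L$. Membership for a class $\mathcal{D}$ is decidable if there is an algorithm which, given a regular language $L$ (presented by a morphism from $A^*$ into a finite monoid and a set of accepting elements), decides whether $L \in \mathcal{D}$. For a morphism $\alpha : A^* \to M$ into a finite monoid, the canonical $\mathcal{C}$-equivalence $\sim_{\mathcal{C},\alpha}$ on $M$ is defined by $s \sim_{\mathcal{C},\alpha} t$ if and only if $s \in F \Leftrightarrow t \in F$ for every $F \subseteq M$ with $\alpha^{-1}(F) \in \mathcal{C}$. Let $\mathcal{C}$ be a prevariety with decidable membership. Then membership for $\mathrm{UPol}(\mathcal{C})$ is decidable. More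 precisely: 1. given a regular language $L$, one can compute its syntactic morphism $\alpha_L : A^* \to M_L$; 2. given a morphism $\alpha : A^* \to M$ into a finite monoid, one can compute the relation $\sim_{\mathcal{C},\alpha}$ on $M$; 3. a regular language $L$ belongs to $\mathrm{UPol}(\mathcal{C})$ if and only if $s^{\omega+1} = s^{\omega} t s^{\omega}$ for all $s, t \in M_L$ with $s \sim_{\mathcal{C},\alpha_L} t$, where $\omega \geq 1$ is such that $s^\omega$ is idempotent for every $s \in M_L$. -/

import Mathlib

universe u

namespace UnambiguousPolynomialClosure

/-! ### Classes of languages -/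

/-- A prevariety: a Boolean algebra of regular languages over `A` that is closed under left and
right quotients by words. -/
structure IsPrevariety {A : Type u} (C : Set (Language A)) : Prop where
  regular : ∀ L ∈ C, L.IsRegular
  empty_mem : (⊥ : Language A) ∈ C
  univ_mem : (⊤ : Language A) ∈ C
  union_mem : ∀ K ∈ C, ∀ L ∈ C, K ⊔ L ∈ C
  inter_mem : ∀ K ∈ C, ∀ L ∈ C, K ⊓ L ∈ C
  compl_mem : ∀ L ∈ C, Lᶜ ∈ C
  left_quotient_mem : ∀ L ∈ C, ∀ x : List A, ({w | x ++ w ∈ L} : Set (List A)) ∈ C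
  right_quotient_mem : ∀ L ∈ C, ∀ x : List A, ({w | w ++ x ∈ L} : Set (List A)) ∈ C

/-- The marked concatenation `K a L`. -/
def markedConcat {A : Type u} (K : Language A) (a : A) (L : Language A) : Language A :=
  {w | ∃ x ∈ K, ∃ y ∈ L, x ++ a :: y = w}

/-- The marked concatenation `K a L` is unambiguous. -/
def IsUnambiguous {A : Type u} (K : Language A) (a : A) (L : Language A) : Prop :=
  ∀ x ∈ K, ∀ x' ∈ K, ∀ y ∈ L, ∀ y' ∈ L, x ++ a :: y = x' ++ a :: y' → x = x' ∧ y = y'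

/-- Membership in the least class that contains `C` and is closed under disjoint union and
unambiguous marked concatenation. -/
inductive MemUPol {A : Type u} (C : Set (Language A)) : Language A → Prop
  | base {L : Language A} : L ∈ C → MemUPol C L
  | disjoint_union {K L : Language A} :
      MemUPol C K → MemUPol C L → Disjoint K L → MemUPol C (K ⊔ L)
  | concat {K L : Language A} {a : A} :
      MemUPol C K → MemUPol C L → IsUnambiguous K a L → MemUPol C (markedConcat K a L)

/-- The unambiguous polynomial closure of `C`. -/
def UPol {A : Type u} (C : Set (Language A)) : Set (Language A) :=
  {L | MemUPol C L}

/-! ### Monoids and morphisms -/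

/-- The language `α⁻¹(F)`. -/
def preimageLanguage {A M : Type u} [Monoid M] (α : FreeMonoid A →* M) (F : Set M) :
    Language A :=
  {w | α (FreeMonoid.ofList w) ∈ F}

/-- The canonical `C`-equivalence on the codomain of `α`. -/
def CanonicalEquiv {A M : Type u} [Monoid M] (C : Set (Language A)) (α : FreeMonoid A →* M)
    (s t : M) : Prop :=
  ∀ F : Set M, preimageLanguage α F ∈ C → (s ∈ F ↔ t ∈ F)

/-- The syntactic congruence of `L`. -/
def syntacticCon {A : Type u} (L : Language A) : Con (FreeMonoid A) where
  r v w := ∀ x y : FreeMonoid A,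
    FreeMonoid.toList (x * v * y) ∈ L ↔ FreeMonoid.toList (x * w * y) ∈ L
  iseqv :=
    ⟨fun _ _ _ => Iff.rfl, fun h x y => (h x y).symm, fun h h' x y => (h x y).trans (h' x y)⟩
  mul' := by
    intro v v' w w' h h' x y
    have h1 := h x (w * y)
    have h2 := h' (x * v') y
    simp only [mul_assoc] at h1 h2 ⊢
    exact h1.trans h2

/-- The syntactic morphism of `L`, from `A*` onto the syntactic monoid of `L`. -/
def syntacticMorphism {A : Type u} (L : Language A) : FreeMonoid A →* (syntacticCon L).Quotient :=
  (syntacticCon L).mk'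

/-- The least `k ≥ 1` such that `s ^ k` is idempotent for every `s : M`. It exists as soon as `M`
is finite, see `omega_spec`. -/
noncomputable def omega (M : Type u) [Monoid M] : ℕ :=
  sInf {k | 0 < k ∧ ∀ s : M, IsIdempotentElem (s ^ k)}

theorem omega_spec (M : Type u) [Monoid M] [Finite M] :
    0 < omega M ∧ ∀ s : M, IsIdempotentElem (s ^ omega M) := by
  have key : ∀ s : M, ∃ k, 0 < k ∧ IsIdempotentElem (s ^ k) := by
    intro s
    obtain ⟨i, j, hne, hij⟩ := Finite.exists_ne_map_eq_of_infinite (fun n : ℕ => s ^ n)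
    wlog hlt : i < j generalizing i j
    · exact this j i hne.symm hij.symm (by omega)
    obtain ⟨d, rfl⟩ := Nat.exists_eq_add_of_lt hlt
    have hper : ∀ m, s ^ (i + m * (d + 1)) = s ^ i := by
      intro m
      induction m with
      | zero => simp
      | succ m ih =>
        have : i + (m + 1) * (d + 1) = (i + m * (d + 1)) + (d + 1) := by ring
        rw [this, pow_add, ih, ← pow_add]
        exact hij.symm
    refine ⟨(i + 1) * (d + 1), by positivity, ?_⟩
    obtain ⟨r, hr⟩ : ∃ r, (i + 1) * (d + 1) = i + r := ⟨(i + 1) * (d + 1) - i, by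
      have : i ≤ (i + 1) * (d + 1) := by nlinarith
      omega⟩
    have h2 : (i + 1) * (d + 1) + (i + 1) * (d + 1) = (i + (i + 1) * (d + 1)) + r := by omega
    rw [IsIdempotentElem, ← pow_add, h2, pow_add, hper, hr, pow_add]
  choose k hk hid using key
  have := Fintype.ofFinite M
  refine Nat.sInf_mem (s := {k | 0 < k ∧ ∀ s : M, IsIdempotentElem (s ^ k)})
    ⟨∏ s, k s, Finset.prod_pos fun s _ => hk s, fun s => ?_⟩
  obtain ⟨c, hc⟩ := Finset.dvd_prod_of_mem k (Finset.mem_univ s)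
  rw [hc, pow_mul]
  exact (hid s).pow c

/-- The equation `s^(ω+1) = s^ω t s^ω` for all `s, t` that are canonically `C`-equivalent. -/
def SatisfiesUPolEquation {A M : Type u} [Monoid M] (C : Set (Language A))
    (α : FreeMonoid A →* M) : Prop :=
  ∀ s t : M, CanonicalEquiv C α s t → s ^ (omega M + 1) = s ^ omega M * t * s ^ omega M

/-! ### Finite presentations of morphisms and regular languages, and decision problems -/

/-- The data `(n, e, T, ℓ)` by which a morphism from `A*` into a finite monoid is given to an
algorithm: `n` is the number of elements of the monoid, which are numbered `0, …, n - 1`, `e` is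
the number of the identity element, `T` is the multiplication table, row by row, and `ℓ` is the
list of images of the letters. -/
abbrev MorphismCode : Type := ℕ × ℕ × List ℕ × List ℕ

namespace MorphismCode

def size (c : MorphismCode) : ℕ := c.1

def one (c : MorphismCode) : ℕ := c.2.1

def table (c : MorphismCode) : List ℕ := c.2.2.1

def letters (c : MorphismCode) : List ℕ := c.2.2.2

/-- The code `c` presents the morphism `α : A* → M`, where `ν` is the numbering of the elements
of `M`. The letters of the alphabet are numbered by `Encodable.encode`. -/
structure Presents {A M : Type u} [Encodable A] [Monoid M] (c : MorphismCode)
    (α : FreeMonoid A →* M) (ν : Fin c.size ≃ M) : Prop where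
  one_eq : c.one = (ν.symm 1 : ℕ)
  table_eq : ∀ i j : Fin c.size, c.table[(i : ℕ) * c.size + j]? = some (ν.symm (ν i * ν j) : ℕ)
  letters_eq : ∀ a : A, c.letters[Encodable.encode a]? = some (ν.symm (α (FreeMonoid.of a)) : ℕ)

end MorphismCode

/-- The data by which a regular language is given to an algorithm: a morphism into a finite
monoid, and the list of the numbers of the accepting elements. -/
abbrev RegularCode : Type := MorphismCode × List ℕ

/-- The code `c` presents the language `L` as recognized by the morphism `α : A* → M`, where `ν`
is the numbering of the elements of `M`. -/
structure RegularCode.Presents {A M : Type u} [Encodable A] [Monoid M] (c : RegularCode)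
    (α : FreeMonoid A →* M) (ν : Fin c.1.size ≃ M) (L : Language A) : Prop where
  morphism : c.1.Presents α ν
  mem_iff : ∀ w : List A, w ∈ L ↔ (ν.symm (α (FreeMonoid.ofList w)) : ℕ) ∈ c.2

/-- `C`-membership is decidable: some computable function decides, given a regular language `L`
as input, whether `L ∈ C`. -/
def DecidableMembership {A : Type u} [Encodable A] (C : Set (Language A)) : Prop :=
  ∃ f : RegularCode → Bool, Computable f ∧
    ∀ (M : Type u) [Monoid M] (c : RegularCode) (α : FreeMonoid A →* M) (ν : Fin c.1.size ≃ M)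
      (L : Language A), c.Presents α ν L → (f c = true ↔ L ∈ C)

/-- The syntactic morphism of an input regular language over `A` (together with its accepting
set) can be computed. -/
def SyntacticMorphismComputable (A : Type u) [Encodable A] : Prop :=
  ∃ g : RegularCode → RegularCode, Computable g ∧
    ∀ (M : Type u) [Monoid M] (c : RegularCode) (α : FreeMonoid A →* M) (ν : Fin c.1.size ≃ M)
      (L : Language A), c.Presents α ν L →
        ∃ ν' : Fin (g c).1.size ≃ (syntacticCon L).Quotient,
          (g c).Presents (syntacticMorphism L) ν' L

/-- The canonical `C`-equivalence of an input morphism from `A*` into a finite monoid can be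
computed. -/
def CanonicalEquivComputable {A : Type u} [Encodable A] (C : Set (Language A)) : Prop :=
  ∃ h : MorphismCode × ℕ × ℕ → Bool, Computable h ∧
    ∀ (M : Type u) [Monoid M] (c : MorphismCode) (α : FreeMonoid A →* M) (ν : Fin c.size ≃ M),
      c.Presents α ν → ∀ i j : Fin c.size, h (c, i, j) = true ↔ CanonicalEquiv C α (ν i) (ν j)

end UnambiguousPolynomialClosure

open UnambiguousPolynomialClosure

namespace UnambiguousPolynomialClosure

/-! ### Finite monoids -/

section FiniteMonoid

variable {M : Type*} [Monoid M]

/-! The heart is the equivalence in item 3; the algorithms then test the equation on tables.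

Sufficiency. Let `c` be the canonical congruence on the syntactic monoid. Each preimage of a
`c`-class lies in `C`, and the task is to build the preimage of a single element from these. One
works with the words `w` whose image lies in a class `q` and satisfies `s * α w * r = m`. If
multiplication by some element of `q` keeps `s` in its R-class and multiplication by some element of
`q` keeps `r` in its L-class, while `q` and `s * q * r` divide each other in the quotient, the
equation forces `s * x * r` to be constant on the class (`mul_mul_eq`); the language is then the
preimage of a class, or empty. Otherwise every word of the class makes `s` leave its R-class (or `r`
its L-class). Cutting at the letter where this first happens is unambiguous: one factor is the
preimage of an element whose class strictly divides `q`, the other is a language of the same kind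
with a smaller ideal `sM` or `Mr`. This gives an outer induction on the two-sided divisors of `q`
and an inner one on `|sM| + |Mr|` (`preimageLanguage_mem_UPol_of_lt`).

Necessity. For a morphism `g` into a finite monoid all of whose fibres lie in `C`, the property that
`g u = g v` implies `u^i v u^j ≡ u^(i+1+j)` for all large `i`, `j`, modulo the syntactic congruence,
survives disjoint unions and unambiguous marked products. For products, a cut too deep inside the
powers could be pumped into two different cuts of one word (`not_two_cuts`), so one of the two
factors contains enough of the powers for its own equation to apply. The equation is then passed
from pairs with `g u = g v` to canonically equivalent elements, because its solution set has its
preimage in `C`.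

Effectiveness. A subset of a finite monoid is a bit mask below `2 ^ n`, so the image of `α`, the
syntactic congruence, `∼` and the equation all reduce to bounded quantification over tables and
finitely many calls to the membership test for `C`. -/

theorem mul_pow_of_fixed {s x : M} (h : s * x = s) (n : ℕ) : s * x ^ n = s := by
  induction n with
  | zero => simp
  | succ n ih => rw [pow_succ, ← mul_assoc, ih, h]

theorem pow_mul_of_fixed {r x : M} (h : x * r = r) (n : ℕ) : x ^ n * r = r := by
  induction n with
  | zero => simp
  | succ n ih => rw [pow_succ, mul_assoc, h, ih]

theorem pow_mul_mul_pow_of_fixed {u x v : M} (h : u * x * v = x) (n : ℕ) :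
    u ^ n * x * v ^ n = x := by
  induction n with
  | zero => simp
  | succ n ih =>
    calc u ^ (n + 1) * x * v ^ (n + 1) = u ^ n * (u * x * v) * v ^ n := by
          rw [pow_succ, pow_succ']; simp only [mul_assoc]
      _ = x := by rw [h, ih]

/-- Stability of finite monoids: iterating gives `x = u ^ n * x * v ^ n`, and the idempotent `v ^ n`
is absorbed on the right. A two-sided return to `x` thus yields a one-sided one. -/
theorem mul_pow_of_two_sided_fixed {u x v : M} (h : u * x * v = x) {n : ℕ}
    (hv : IsIdempotentElem (v ^ n)) : x * v ^ n = x := by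
  have h1 := pow_mul_mul_pow_of_fixed h n
  calc x * v ^ n = u ^ n * x * (v ^ n * v ^ n) := by rw [← mul_assoc, h1]
    _ = x := by rw [hv.eq, h1]

theorem pow_mul_of_two_sided_fixed {u x v : M} (h : u * x * v = x) {n : ℕ}
    (hu : IsIdempotentElem (u ^ n)) : u ^ n * x = x := by
  have h1 := pow_mul_mul_pow_of_fixed h n
  calc u ^ n * x = u ^ n * u ^ n * x * v ^ n := by
        nth_rw 1 [← h1]; simp only [mul_assoc]
    _ = x := by rw [hu.eq, h1]

theorem coe_pow_quotient {c : Con M} (x : M) (n : ℕ) :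
    ((x ^ n : M) : c.Quotient) = (x : c.Quotient) ^ n := rfl

/-- `n` is a positive exponent that makes every element idempotent and for which the equation
`s ^ (n + 1) = s ^ n * t * s ^ n` holds whenever `c s t`. -/
structure IsLocallyTrivialOver (c : Con M) (n : ℕ) : Prop where
  pos : 0 < n
  idem : ∀ s : M, IsIdempotentElem (s ^ n)
  eqn : ∀ s t : M, c s t → s ^ (n + 1) = s ^ n * t * s ^ n

namespace IsLocallyTrivialOver

variable {c : Con M} {n : ℕ}

theorem op (h : IsLocallyTrivialOver c n) : IsLocallyTrivialOver (Con.op c) n where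
  pos := h.pos
  idem s := by
    have := h.idem s.unop
    apply MulOpposite.unop_injective
    simpa [IsIdempotentElem] using this
  eqn s t hst := by
    have := h.eqn s.unop t.unop (c.symm hst)
    apply MulOpposite.unop_injective
    simpa [mul_assoc] using this

theorem idem_quotient (h : IsLocallyTrivialOver c n) (q : c.Quotient) :
    IsIdempotentElem (q ^ n) := by
  induction q using Con.induction_on with
  | H s => exact congrArg (fun x : M => (x : c.Quotient)) (h.idem s)

/-- Multiplying the equation on the left by `s` makes every power of `x` next to `s` disappear. -/
theorem mul_fix (h : IsLocallyTrivialOver c n) {s x y : M} (hs : s * x = s) (hxy : c x y) :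
    s * y * x ^ n = s := by
  have h1 := congrArg (s * ·) (h.eqn x y hxy)
  simp only [mul_pow_of_fixed hs, ← mul_assoc] at h1
  exact h1.symm

theorem fix_mul (h : IsLocallyTrivialOver c n) {r x y : M} (hr : x * r = r) (hxy : c x y) :
    x ^ n * y * r = r := by
  have h1 := congrArg (· * r) (h.eqn x y hxy)
  simp only [pow_mul_of_fixed hr, mul_assoc] at h1
  rw [mul_assoc]
  exact h1.symm

/-- Whether right multiplication by `a` keeps `s` in its R-class depends only on the `c`-class of
`a`: `mul_fix` applies to `a * z` and `b * z`. -/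
theorem exists_mul_right (h : IsLocallyTrivialOver c n) {s a b : M} (hab : c a b)
    (hs : ∃ z, s * a * z = s) : ∃ z, s * b * z = s := by
  obtain ⟨z, hz⟩ := hs
  refine ⟨z * (a * z) ^ n, ?_⟩
  have := h.mul_fix (s := s) (x := a * z) (y := b * z) (by rw [← mul_assoc, hz])
    (c.mul hab (c.refl z))
  simpa only [mul_assoc] using this

theorem exists_mul_left (h : IsLocallyTrivialOver c n) {r a b : M} (hab : c a b)
    (hr : ∃ z, z * a * r = r) : ∃ z, z * b * r = r := by
  obtain ⟨z, hz⟩ := hr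
  refine ⟨(z * a) ^ n * z, ?_⟩
  have := h.fix_mul (r := r) (x := z * a) (y := z * b) hz (c.mul (c.refl z) hab)
  simpa only [mul_assoc] using this

/-- Stability is available in the quotient, where it gives a return from `s * a * r` to `s`. The
equation for the idempotent `g = (a * z) ^ n`, which fixes `s`, lifts this return to `M`. -/
theorem exists_mul_right_of_two_sided (h : IsLocallyTrivialOver c n) {s a r z k l : M}
    (hz : s * a * z = s) (ha : c (k * (s * a * r) * l) a) : ∃ y, s * a * r * y = s := by
  obtain ⟨n', rfl⟩ := Nat.exists_eq_succ_of_ne_zero h.pos.ne'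
  set n := n'.succ with hn
  set W := a * r * l * z with hW
  set y := l * z * W ^ n' with hy
  set g := (a * z) ^ n with hg
  have hsg : s * g = s := mul_pow_of_fixed (by rw [← mul_assoc, hz]) n
  have haq : ((k * (s * a * r) * l : M) : c.Quotient) = a := (Con.eq c).2 ha
  have hzq : (s * a * z : c.Quotient) = s := congrArg (fun x : M => (x : c.Quotient)) hz
  have hsgq : (s * g : c.Quotient) = s := congrArg (fun x : M => (x : c.Quotient)) hsg
  -- the image of `s` in the quotient is fixed by that of `a * r * y`
  have hpW : (s * W : c.Quotient) * ((W ^ n' : M) : c.Quotient) = s := by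
    have h1 : ((s * k : M) : c.Quotient) * s * (W : M) = s := by
      nth_rw 2 [← hzq]
      rw [← haq]
      simp only [hW, Con.coe_mul, mul_assoc]
    have h2 := mul_pow_of_two_sided_fixed h1 (h.idem_quotient _)
    rw [hn, pow_succ'] at h2
    rw [mul_assoc]
    exact h2
  have hpy : (s : c.Quotient) * ((a * r * y : M) : c.Quotient) = s := by
    rw [← hpW]
    nth_rw 1 [hpW]
    simp only [hy, hW, Con.coe_mul, mul_assoc]
  -- Left-hand stability puts the class of `g` into the left ideal generated by `s`, so whatever
  -- fixes `s` on the right in the quotient also fixes `g`.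
  have hgk : (g : c.Quotient) = ((k * s) ^ n' * k : M) * s := by
    have hi : ((k * s : M) : c.Quotient) * g * ((W * (a * z) ^ n' : M) : c.Quotient) = g := by
      have : (g : c.Quotient) = a * z * ((a * z) ^ n' : M) := by
        rw [hg, hn, pow_succ']; rfl
      nth_rw 2 [this]
      rw [Con.coe_mul, mul_assoc (k : c.Quotient), hsgq, ← haq]
      simp only [hW, Con.coe_mul, mul_assoc]
    have h2 := pow_mul_of_two_sided_fixed hi (h.idem_quotient _)
    rw [← h2]
    have h3 : ((k * s : M) : c.Quotient) ^ n = ((k * s) ^ n' * k : M) * s := by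
      rw [hn, pow_succ]; simp only [Con.coe_mul, coe_pow_quotient, mul_assoc]
    rw [h3, mul_assoc, hsgq]
  have hgC : c g (g * (a * r * y) * g) := by
    rw [← Con.eq]
    have h1 : (g : c.Quotient) * ((a * r * y : M) : c.Quotient) = g := by
      rw [hgk, mul_assoc, hpy]
    have h2 : (g * g : c.Quotient) = g :=
      congrArg (fun x : M => (x : c.Quotient)) (h.idem (a * z)).eq
    rw [Con.coe_mul, Con.coe_mul g, h1, h2]
  -- As `g` is idempotent, its powers in the equation collapse, and an equivalence in the quotient
  -- becomes an equality in `M`.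
  have hgg : g * (a * r * y) * g = g := by
    have h1 := h.eqn _ _ hgC
    have h2 : IsIdempotentElem g := h.idem (a * z)
    rw [h2.pow_succ_eq, h2.pow_eq h.pos.ne'] at h1
    calc g * (a * r * y) * g = g * g * (a * r * y) * (g * g) := by rw [h2.eq]
      _ = g * (g * (a * r * y) * g) * g := by simp only [mul_assoc]
      _ = g := h1.symm
  refine ⟨y * g, ?_⟩
  calc s * a * r * (y * g) = s * (a * r * y * g) := by simp only [mul_assoc]
    _ = s * (g * (a * r * y) * g) := by
        conv_lhs => rw [← hsg]
        simp only [mul_assoc]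
    _ = s := by rw [hgg, hsg]

/-- The right-hand version, read in the opposite monoid. -/
theorem exists_mul_left_of_two_sided (h : IsLocallyTrivialOver c n) {s a r z k l : M}
    (hz : z * a * r = r) (ha : c (k * (s * a * r) * l) a) : ∃ y, y * (s * a * r) = r := by
  obtain ⟨y, hy⟩ := h.op.exists_mul_right_of_two_sided (s := .op r) (a := .op a) (r := .op s)
    (z := .op z) (k := .op l) (l := .op k)
    (by rw [← MulOpposite.op_mul, ← MulOpposite.op_mul, ← mul_assoc, hz])
    (by
      refine c.symm ?_
      simpa [mul_assoc] using ha)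
  refine ⟨y.unop, ?_⟩
  have := congrArg MulOpposite.unop hy
  simpa [mul_assoc] using this

/-- With `x = a * r * Y`, which fixes `s`, `mul_fix` gives `s = s * (b * r * Y) * x ^ n`.
Multiplying by `a * r` on the right, everything after `s * b` collapses to `r`, because `r * (Y * a
* r) = r`. -/
theorem mul_mul_eq_of_fixed (h : IsLocallyTrivialOver c n) {s a b r : M} (hab : c a b)
    (hs : ∃ y, s * a * r * y = s) (hr : ∃ y, y * (s * a * r) = r) : s * a * r = s * b * r := by
  obtain ⟨Y, hY⟩ := hs
  obtain ⟨Y', hY'⟩ := hr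
  have h1 : r * (Y * a * r) = r := by
    calc r * (Y * a * r) = Y' * (s * a * r * Y) * a * r := by
          nth_rw 1 [← hY']; simp only [mul_assoc]
      _ = r := by rw [hY, mul_assoc, mul_assoc, ← mul_assoc s, hY']
  have h2 : ∀ k, r * Y * (a * r * Y) ^ k * (a * r) = r := by
    intro k
    induction k with
    | zero => simpa [mul_assoc] using h1
    | succ k ih =>
      calc r * Y * (a * r * Y) ^ (k + 1) * (a * r)
          = r * Y * (a * r * Y) ^ k * (a * r) * (Y * a * r) := by
            rw [pow_succ]; simp only [mul_assoc]
        _ = r := by rw [ih, h1]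
  have h3 := h.mul_fix (s := s) (x := a * r * Y) (y := b * r * Y)
    (by simpa only [mul_assoc] using hY)
    (c.mul (c.mul hab (c.refl r)) (c.refl Y))
  calc s * a * r = s * (b * r * Y) * (a * r * Y) ^ n * (a * r) := by rw [h3, mul_assoc]
    _ = s * b * (r * Y * (a * r * Y) ^ n * (a * r)) := by simp only [mul_assoc]
    _ = s * b * r := by rw [h2]

theorem mul_mul_eq (h : IsLocallyTrivialOver c n) {s a b r k l : M} (hab : c a b)
    (hs : ∃ z, s * a * z = s) (hr : ∃ z, z * a * r = r) (ha : c (k * (s * a * r) * l) a) :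
    s * a * r = s * b * r :=
  h.mul_mul_eq_of_fixed hab (hs.elim fun _ hz => h.exists_mul_right_of_two_sided hz ha)
    (hr.elim fun _ hz => h.exists_mul_left_of_two_sided hz ha)

/-- If the class of `a` were recovered from a multiple of that of `a * b`, stability would give an
element `a * b * e` equivalent to `a`. By `exists_mul_right` it would keep `s` in its R-class, and
so would `a * b`. Hence the part of a word before a drop has a class strictly J-above that of the
whole word. -/
theorem not_two_sided_of_drop_right (h : IsLocallyTrivialOver c n) {s a b : M}
    (hs : ∃ z, s * a * z = s) (hd : ¬ ∃ z, s * (a * b) * z = s) (q k l : c.Quotient) :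
    k * ((a * b : M) * q) * l ≠ a := by
  intro he
  obtain ⟨q, rfl⟩ := Con.mk'_surjective q
  obtain ⟨l, rfl⟩ := Con.mk'_surjective l
  have h1 := mul_pow_of_two_sided_fixed (u := k) (x := (a : c.Quotient))
    (v := ((b * q * l : M) : c.Quotient)) (n := n)
    (by simpa only [Con.coe_mk', Con.coe_mul, mul_assoc] using he) (h.idem_quotient _)
  obtain ⟨n', rfl⟩ := Nat.exists_eq_succ_of_ne_zero h.pos.ne'
  have h2 : c a (a * b * (q * l * (b * q * l) ^ n')) := by
    rw [← Con.eq, ← h1, pow_succ']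
    simp only [Con.coe_mul, coe_pow_quotient, mul_assoc]
  obtain ⟨z, hz⟩ := h.exists_mul_right h2 hs
  exact hd ⟨q * l * (b * q * l) ^ n' * z, by
    rw [← mul_assoc, ← mul_assoc]; simpa only [mul_assoc] using hz⟩

theorem not_two_sided_of_drop_left (h : IsLocallyTrivialOver c n) {r a b : M}
    (hr : ∃ z, z * a * r = r) (hd : ¬ ∃ z, z * (b * a) * r = r) (q k l : c.Quotient) :
    k * (q * (b * a : M)) * l ≠ a := by
  intro he
  obtain ⟨q, rfl⟩ := Con.mk'_surjective q
  obtain ⟨k, rfl⟩ := Con.mk'_surjective k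
  have h1 := pow_mul_of_two_sided_fixed (u := ((k * q * b : M) : c.Quotient))
    (x := (a : c.Quotient)) (v := l) (n := n)
    (by simpa only [Con.coe_mk', Con.coe_mul, mul_assoc] using he) (h.idem_quotient _)
  obtain ⟨n', rfl⟩ := Nat.exists_eq_succ_of_ne_zero h.pos.ne'
  have h2 : c a ((k * q * b) ^ n' * (k * q) * (b * a)) := by
    rw [← Con.eq, ← h1, pow_succ]
    simp only [Con.coe_mul, coe_pow_quotient, mul_assoc]
  obtain ⟨z, hz⟩ := h.exists_mul_left h2 hr
  exact hd ⟨z * ((k * q * b) ^ n' * (k * q)), by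
    nth_rw 2 [← hz]; simp only [mul_assoc]⟩

end IsLocallyTrivialOver

end FiniteMonoid

/-! ### Prevarieties and the canonical equivalence -/

section Prevariety

variable {A : Type u} {C : Set (Language A)}

theorem mem_of_mem_iff {D : Set (Language A)} {K L : Language A} (hK : K ∈ D)
    (h : ∀ w, w ∈ L ↔ w ∈ K) : L ∈ D := by
  have : L = K := Set.ext (α := List A) h
  rwa [this]

theorem IsPrevariety.iUnion_mem (hC : IsPrevariety C) {ι : Type*} [Finite ι]
    (f : ι → Language A) (hf : ∀ i, f i ∈ C) {L : Language A} (hL : ∀ w, w ∈ L ↔ ∃ i, w ∈ f i) :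
    L ∈ C := by
  classical
  have := Fintype.ofFinite ι
  suffices ∀ (s : Finset ι) (L : Language A), (∀ w, w ∈ L ↔ ∃ i ∈ s, w ∈ f i) → L ∈ C from
    this Finset.univ L (by simpa using hL)
  intro s
  induction s using Finset.induction_on with
  | empty =>
    exact fun L hL => mem_of_mem_iff hC.empty_mem fun w => (hL w).trans
      ⟨fun ⟨_, h, _⟩ => absurd h (Finset.notMem_empty _), False.elim⟩
  | insert i s _ ih =>
    intro L hL
    refine mem_of_mem_iff (hC.union_mem _ (hf i) _
      (ih ({w | ∃ j ∈ s, w ∈ f j} : Set (List A)) fun w => Iff.rfl)) fun w => ?_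
    rw [hL]
    change (∃ j ∈ insert i s, w ∈ f j) ↔ w ∈ f i ∨ ∃ j ∈ s, w ∈ f j
    simp

theorem IsPrevariety.iInter_mem (hC : IsPrevariety C) {ι : Type*} [Finite ι]
    (f : ι → Language A) (hf : ∀ i, f i ∈ C) {L : Language A} (hL : ∀ w, w ∈ L ↔ ∀ i, w ∈ f i) :
    L ∈ C := by
  refine mem_of_mem_iff (hC.compl_mem _ (hC.iUnion_mem (fun i => (f i)ᶜ)
    (fun i => hC.compl_mem _ (hf i)) (L := Lᶜ) fun w => ?_)) fun w => ?_
  · change ¬ w ∈ L ↔ ∃ i, ¬ w ∈ f i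
    rw [hL]
    simp
  · exact not_not.symm

variable {M : Type u} [Monoid M]

/-- For a surjective morphism, the canonical equivalence is a congruence. -/
def canonicalCon (hC : IsPrevariety C) (α : FreeMonoid A →* M) (hα : Function.Surjective α) :
    Con M where
  r := CanonicalEquiv C α
  iseqv := ⟨fun _ _ _ => Iff.rfl, fun h F hF => (h F hF).symm,
    fun h h' F hF => (h F hF).trans (h' F hF)⟩
  mul' := by
    intro s s' t t' hs ht F hF
    -- Closure under quotients only handles translations by images of words; the route `s * t`, `s'
    -- * t`, `s' * t'` translates by `t` and by `s'` only.
    obtain ⟨x, rfl⟩ := hα s'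
    obtain ⟨y, rfl⟩ := hα t
    have h1 : s * α y ∈ F ↔ α x * α y ∈ F := by
      refine hs {m | m * α y ∈ F} ?_
      refine mem_of_mem_iff (hC.right_quotient_mem _ hF y.toList) fun w => ?_
      change α _ * α y ∈ F ↔ α (FreeMonoid.ofList w * y) ∈ F
      rw [map_mul]
    have h2 : α x * α y ∈ F ↔ α x * t' ∈ F := by
      refine ht {m | α x * m ∈ F} ?_
      refine mem_of_mem_iff (hC.left_quotient_mem _ hF x.toList) fun w => ?_
      change α x * α _ ∈ F ↔ α (x * FreeMonoid.ofList w) ∈ F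
      rw [map_mul]
    exact h1.trans h2

/-- The class is the intersection, over the finitely many `t`, of a set containing `a` that omits
`t` whenever `t` is inequivalent to `a`. -/
theorem IsPrevariety.canonical_class_mem [Finite M] (hC : IsPrevariety C) (α : FreeMonoid A →* M)
    (a : M) : preimageLanguage α {t | CanonicalEquiv C α a t} ∈ C := by
  have key : ∀ t : M, ∃ F : Set M, preimageLanguage α F ∈ C ∧ a ∈ F ∧
      (t ∈ F → CanonicalEquiv C α a t) := by
    intro t
    by_cases h : CanonicalEquiv C α a t
    · exact ⟨Set.univ, hC.univ_mem, trivial, fun _ => h⟩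
    · simp only [CanonicalEquiv, not_forall] at h
      obtain ⟨F, hF, hat⟩ := h
      by_cases ha : a ∈ F
      · exact ⟨F, hF, ha, fun ht => (hat ⟨fun _ => ht, fun _ => ha⟩).elim⟩
      · refine ⟨Fᶜ, hC.compl_mem _ hF, ha, fun ht => (hat ⟨fun h => (ha h).elim, ?_⟩).elim⟩
        exact fun h => (ht h).elim
  choose F hF haF hFt using key
  refine hC.iInter_mem (fun t => preimageLanguage α (F t)) hF fun w => ?_
  change CanonicalEquiv C α a (α (FreeMonoid.ofList w)) ↔ ∀ t, α (FreeMonoid.ofList w) ∈ F t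
  exact ⟨fun h t => (h _ (hF t)).1 (haF t), fun h => hFt _ (h _)⟩

end Prevariety

/-! ### Regular languages and syntactic morphisms -/

section Syntactic

variable {A : Type u}

theorem syntacticMorphism_surjective (L : Language A) :
    Function.Surjective (syntacticMorphism L) := Con.mk'_surjective

theorem syntacticMorphism_eq_iff {L : Language A} {v w : FreeMonoid A} :
    syntacticMorphism L v = syntacticMorphism L w ↔ syntacticCon L v w := Con.eq _

theorem mem_of_syntacticMorphism_eq {L : Language A} {v w : FreeMonoid A}
    (h : syntacticMorphism L v = syntacticMorphism L w) (x y : FreeMonoid A) :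
    FreeMonoid.toList (x * v * y) ∈ L ↔ FreeMonoid.toList (x * w * y) ∈ L :=
  syntacticMorphism_eq_iff.1 h x y

/-- The set of elements of the syntactic monoid that are images of words of `L`. -/
def syntacticImage (L : Language A) : Set (syntacticCon L).Quotient :=
  {m | ∃ w : FreeMonoid A, w.toList ∈ L ∧ syntacticMorphism L w = m}

theorem mem_syntacticImage {L : Language A} {w : FreeMonoid A} :
    syntacticMorphism L w ∈ syntacticImage L ↔ w.toList ∈ L := by
  refine ⟨fun ⟨v, hv, hvw⟩ => ?_, fun h => ⟨w, h, rfl⟩⟩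
  simpa using (mem_of_syntacticMorphism_eq hvw 1 1).1 (by simpa using hv)

theorem preimageLanguage_syntacticImage (L : Language A) :
    preimageLanguage (syntacticMorphism L) (syntacticImage L) = L := by
  ext w
  exact mem_syntacticImage

/-- Words acting in the same way on the states of an automaton are syntactically congruent. -/
theorem finite_syntacticCon_quotient {L : Language A} (hL : L.IsRegular) :
    Finite (syntacticCon L).Quotient := by
  obtain ⟨σ, _, D, rfl⟩ := hL
  let f : (syntacticCon D.accepts).Quotient → σ → σ :=
    fun q s => D.evalFrom s (FreeMonoid.toList q.out)
  have hf : Function.Injective f := by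
    intro p q hpq
    have hp : syntacticMorphism D.accepts p.out = p := Quotient.out_eq _
    have hq : syntacticMorphism D.accepts q.out = q := Quotient.out_eq _
    rw [← hp, ← hq, syntacticMorphism_eq_iff]
    intro x y
    have := congrFun hpq (D.eval x.toList)
    simp only [FreeMonoid.toList_mul, DFA.mem_accepts, DFA.eval, DFA.evalFrom_of_append]
    simp only [f, DFA.eval] at this
    rw [this]
  exact Finite.of_injective f hf

theorem isRegular_of_recognized {M : Type*} [Monoid M] [Finite M] (α : FreeMonoid A →* M)
    (F : Set M) (L : Language A) (h : ∀ w : List A, w ∈ L ↔ α (FreeMonoid.ofList w) ∈ F) :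
    L.IsRegular := by
  apply Language.IsRegular.of_finite_range_leftQuotient
  refine (Set.finite_range fun m : M => ({w | m * α (FreeMonoid.ofList w) ∈ F} : Language A)).subset
    ?_
  rintro _ ⟨x, rfl⟩
  refine ⟨α (FreeMonoid.ofList x), ?_⟩
  refine Set.ext fun w => ?_
  change _ ↔ x ++ w ∈ L
  rw [h, FreeMonoid.ofList_append, map_mul]
  rfl

end Syntactic

/-! ### Unambiguous polynomial closure -/

section UPol

variable {A : Type u} {C : Set (Language A)}

theorem iUnion_mem_UPol (hC : IsPrevariety C) {ι : Type*} [Finite ι] (f : ι → Language A)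
    (hf : ∀ i, f i ∈ UPol C) (hdisj : ∀ i j w, w ∈ f i → w ∈ f j → i = j) {L : Language A}
    (hL : ∀ w, w ∈ L ↔ ∃ i, w ∈ f i) : L ∈ UPol C := by
  classical
  have := Fintype.ofFinite ι
  suffices ∀ (s : Finset ι) (L : Language A), (∀ w, w ∈ L ↔ ∃ i ∈ s, w ∈ f i) → L ∈ UPol C from
    this Finset.univ L (by simpa using hL)
  intro s
  induction s using Finset.induction_on with
  | empty =>
    exact fun L hL => mem_of_mem_iff (MemUPol.base hC.empty_mem) fun w => (hL w).trans
      ⟨fun ⟨_, h, _⟩ => absurd h (Finset.notMem_empty _), False.elim⟩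
  | insert i s hi ih =>
    intro L hL
    refine mem_of_mem_iff (MemUPol.disjoint_union (hf i)
      (ih ({w | ∃ j ∈ s, w ∈ f j} : Set (List A)) fun w => Iff.rfl) ?_) fun w => ?_
    · refine Set.disjoint_left (α := List A).2 ?_
      rintro w hw ⟨j, hj, hwj⟩
      exact hi (hdisj i j w hw hwj ▸ hj)
    · rw [hL]
      change (∃ j ∈ insert i s, w ∈ f j) ↔ w ∈ f i ∨ ∃ j ∈ s, w ∈ f j
      simp

/-- For a prefix-closed property, `x` must be the longest prefix that has it. This is the source of
all unambiguity in the construction. -/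
theorem cut_eq_of_left {P : List A → Prop} (hP : ∀ x y, P (x ++ y) → P x) {x y x' y' : List A}
    {a a' : A} (hx : P x) (ha : ¬ P (x ++ [a])) (hx' : P x') (ha' : ¬ P (x' ++ [a']))
    (h : x ++ a :: y = x' ++ a' :: y') : x = x' ∧ a = a' ∧ y = y' := by
  rw [List.append_eq_append_iff] at h
  rcases h with ⟨z, rfl, hz⟩ | ⟨z, rfl, hz⟩
  · cases z with
    | nil => simpa using hz
    | cons b z =>
      obtain ⟨rfl, _⟩ : a = b ∧ _ := by simpa using hz
      exact (ha (hP _ z (by simpa using hx'))).elim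
  · cases z with
    | nil => simpa [eq_comm] using hz
    | cons b z =>
      obtain ⟨rfl, _⟩ : a' = b ∧ _ := by simpa using hz
      exact (ha' (hP _ z (by simpa using hx))).elim

theorem cut_eq_of_right {P : List A → Prop} (hP : ∀ x y, P (x ++ y) → P y) {x y x' y' : List A}
    {a a' : A} (hy : P y) (ha : ¬ P (a :: y)) (hy' : P y') (ha' : ¬ P (a' :: y'))
    (h : x ++ a :: y = x' ++ a' :: y') : x = x' ∧ a = a' ∧ y = y' := by
  rw [List.append_eq_append_iff] at h
  rcases h with ⟨z, rfl, hz⟩ | ⟨z, rfl, hz⟩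
  · cases z with
    | nil => simpa using hz
    | cons b z =>
      obtain ⟨rfl, rfl⟩ : a = b ∧ y = z ++ a' :: y' := by simpa using hz
      exact (ha' (hP _ _ hy)).elim
  · cases z with
    | nil => simpa [eq_comm] using hz
    | cons b z =>
      obtain ⟨rfl, rfl⟩ : a' = b ∧ y' = z ++ a :: y := by simpa using hz
      exact (ha (hP _ _ hy')).elim

theorem exists_cut_left {P : List A → Prop} (h1 : P []) (w : List A) (hw : ¬ P w) :
    ∃ x a y, w = x ++ a :: y ∧ P x ∧ ¬ P (x ++ [a]) := by
  induction w using List.reverseRecOn with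
  | nil => exact (hw h1).elim
  | append_singleton w a ih =>
    by_cases h : P w
    · exact ⟨w, a, [], rfl, h, hw⟩
    · obtain ⟨x, b, y, rfl, hx⟩ := ih h
      exact ⟨x, b, y ++ [a], by simp, hx⟩

theorem exists_cut_right {P : List A → Prop} (h1 : P []) (w : List A) (hw : ¬ P w) :
    ∃ x a y, w = x ++ a :: y ∧ P y ∧ ¬ P (a :: y) := by
  induction w with
  | nil => exact (hw h1).elim
  | cons a w ih =>
    by_cases h : P w
    · exact ⟨[], a, w, rfl, h, hw⟩
    · obtain ⟨x, b, y, rfl, hx⟩ := ih h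
      exact ⟨a :: x, b, y, by simp, hx⟩

variable {M : Type u} [Monoid M] {c : Con M} {n : ℕ}

/-- The words whose image lies in the class `q` and is sent to `m` by `x ↦ s * x * r`. -/
def contextLanguage (α : FreeMonoid A →* M) (c : Con M) (q : c.Quotient) (s r m : M) :
    Language A :=
  {w | (α (FreeMonoid.ofList w) : c.Quotient) = q ∧ s * α (FreeMonoid.ofList w) * r = m}

theorem mem_contextLanguage {α : FreeMonoid A →* M} {q : c.Quotient} {s r m : M} {w : List A} :
    w ∈ contextLanguage α c q s r m ↔
      (α (FreeMonoid.ofList w) : c.Quotient) = q ∧ s * α (FreeMonoid.ofList w) * r = m := Iff.rfl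

theorem mem_preimageLanguage {α : FreeMonoid A →* M} {F : Set M} {w : List A} :
    w ∈ preimageLanguage α F ↔ α (FreeMonoid.ofList w) ∈ F := Iff.rfl

/-- Each word is cut after its longest prefix `x` keeping `s` in its R-class. The image of `x`, the
next letter and the class of the remaining suffix index a finite disjoint union of unambiguous
products. The hypotheses `h1` and `h2` are the places for the outer and the inner induction. -/
theorem contextLanguage_mem_UPol_of_drop_right [Finite A] [Finite M] (hC : IsPrevariety C)
    (α : FreeMonoid A →* M) (h : IsLocallyTrivialOver c n) (q : c.Quotient) (s r m : M)
    (h1 : ∀ m₁ : M, (∃ l, m₁ * l = q) → (∀ k l, k * q * l ≠ m₁) →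
      preimageLanguage α {m₁} ∈ UPol C)
    (h2 : ∀ (x : M) (p : c.Quotient), x * p = q → (¬ ∃ z, s * x * z = s) →
      contextLanguage α c p (s * x) r m ∈ UPol C)
    (h3 : ∀ a : M, (a : c.Quotient) = q → ¬ ∃ z, s * a * z = s) :
    contextLanguage α c q s r m ∈ UPol C := by
  let ι := {p : M × A × c.Quotient // (∃ z, s * p.1 * z = s) ∧
    (¬ ∃ z, s * (p.1 * α (.of p.2.1)) * z = s) ∧ (p.1 * α (.of p.2.1) : M) * p.2.2 = q}
  let P : List A → Prop := fun w => ∃ z, s * α (.ofList w) * z = s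
  have hP : ∀ x y, P (x ++ y) → P x := by
    rintro x y ⟨z, hz⟩
    refine ⟨α (.ofList y) * z, ?_⟩
    simpa [mul_assoc] using hz
  let f : ι → Language A := fun i => markedConcat (preimageLanguage α {i.1.1}) i.1.2.1
    (contextLanguage α c i.1.2.2 (s * (i.1.1 * α (.of i.1.2.1))) r m)
  have hcut : ∀ (i j : ι) (x x' y y' : List A), x ∈ preimageLanguage α {i.1.1} →
      x' ∈ preimageLanguage α {j.1.1} → x ++ i.1.2.1 :: y = x' ++ j.1.2.1 :: y' →
      x = x' ∧ i.1.2.1 = j.1.2.1 ∧ y = y' := by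
    rintro ⟨⟨m₁, a, q₂⟩, hi⟩ ⟨⟨m₁', a', q₂'⟩, hj⟩ x x' y y' hx hx' he
    simp only [mem_preimageLanguage, Set.mem_singleton_iff] at hx hx'
    subst hx hx'
    refine cut_eq_of_left hP hi.1 ?_ hj.1 ?_ he
    · simpa [P, FreeMonoid.ofList_append] using hi.2.1
    · simpa [P, FreeMonoid.ofList_append] using hj.2.1
  have : Finite c.Quotient := Quotient.finite _
  refine iUnion_mem_UPol hC f ?_ ?_ fun w => ?_
  rotate_left 2
  · constructor
    · rintro ⟨hwq, hwm⟩
      obtain ⟨x, a, y, rfl, hx, hxa⟩ := exists_cut_left (P := P) ⟨1, by simp⟩ w (h3 _ hwq)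
      refine ⟨⟨⟨α (.ofList x), a, (α (.ofList y) : M)⟩, hx, ?_, ?_⟩, x, rfl, y, ⟨rfl, ?_⟩, rfl⟩
      · simpa [P, FreeMonoid.ofList_append] using hxa
      · rw [← hwq]
        simp [FreeMonoid.ofList_append, FreeMonoid.ofList_cons, mul_assoc]
      · rw [← hwm]
        simp [FreeMonoid.ofList_append, FreeMonoid.ofList_cons, mul_assoc]
    · rintro ⟨⟨⟨m₁, a, q₂⟩, hi⟩, x, hx, y, ⟨hyq, hym⟩, rfl⟩
      simp only [mem_preimageLanguage, Set.mem_singleton_iff] at hx hyq hym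
      subst hx
      refine ⟨?_, ?_⟩
      · refine Eq.trans ?_ hi.2.2
        subst hyq
        simp [FreeMonoid.ofList_append, FreeMonoid.ofList_cons, mul_assoc]
      · rw [← hym]
        simp [FreeMonoid.ofList_append, FreeMonoid.ofList_cons, mul_assoc]
  · rintro ⟨⟨m₁, a, q₂⟩, hi⟩
    refine MemUPol.concat (h1 m₁ ⟨α (.of a) * q₂, ?_⟩ ?_) (h2 _ _ hi.2.2 hi.2.1) ?_
    · rw [← hi.2.2, ← mul_assoc]; rfl
    · intro k l
      rw [← hi.2.2]
      exact h.not_two_sided_of_drop_right hi.1 hi.2.1 q₂ k l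
    · intro x hx x' hx' y _ y' _ he
      have := hcut ⟨_, hi⟩ ⟨_, hi⟩ x x' y y' hx hx' he
      exact ⟨this.1, this.2.2⟩
  · rintro ⟨⟨m₁, a, q₂⟩, hi⟩ ⟨⟨m₁', a', q₂'⟩, hj⟩ w ⟨x, hx, y, ⟨hy, _⟩, rfl⟩
      ⟨x', hx', y', ⟨hy', _⟩, he⟩
    obtain ⟨rfl, rfl, rfl⟩ := hcut ⟨_, hi⟩ ⟨_, hj⟩ x x' y y' hx hx' he.symm
    simp only [mem_preimageLanguage, Set.mem_singleton_iff] at hx hx' hy hy'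
    subst hx hx' hy hy'
    rfl

/-- Mirror image: the cut precedes the longest suffix that keeps `r` in its L-class. -/
theorem contextLanguage_mem_UPol_of_drop_left [Finite A] [Finite M] (hC : IsPrevariety C)
    (α : FreeMonoid A →* M) (h : IsLocallyTrivialOver c n) (q : c.Quotient) (s r m : M)
    (h1 : ∀ m₁ : M, (∃ l, l * m₁ = q) → (∀ k l, k * q * l ≠ m₁) →
      preimageLanguage α {m₁} ∈ UPol C)
    (h2 : ∀ (x : M) (p : c.Quotient), p * x = q → (¬ ∃ z, z * x * r = r) →
      contextLanguage α c p s (x * r) m ∈ UPol C)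
    (h3 : ∀ a : M, (a : c.Quotient) = q → ¬ ∃ z, z * a * r = r) :
    contextLanguage α c q s r m ∈ UPol C := by
  let ι := {p : M × A × c.Quotient // (∃ z, z * p.1 * r = r) ∧
    (¬ ∃ z, z * (α (.of p.2.1) * p.1) * r = r) ∧ p.2.2 * (α (.of p.2.1) * p.1 : M) = q}
  let P : List A → Prop := fun w => ∃ z, z * α (.ofList w) * r = r
  have hP : ∀ x y, P (x ++ y) → P y := by
    rintro x y ⟨z, hz⟩
    refine ⟨z * α (.ofList x), ?_⟩
    simpa [mul_assoc] using hz
  let f : ι → Language A := fun i => markedConcat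
    (contextLanguage α c i.1.2.2 s (α (.of i.1.2.1) * i.1.1 * r) m) i.1.2.1
    (preimageLanguage α {i.1.1})
  have hcut : ∀ (i j : ι) (x x' y y' : List A), y ∈ preimageLanguage α {i.1.1} →
      y' ∈ preimageLanguage α {j.1.1} → x ++ i.1.2.1 :: y = x' ++ j.1.2.1 :: y' →
      x = x' ∧ i.1.2.1 = j.1.2.1 ∧ y = y' := by
    rintro ⟨⟨m₁, a, q₂⟩, hi⟩ ⟨⟨m₁', a', q₂'⟩, hj⟩ x x' y y' hy hy' he
    simp only [mem_preimageLanguage, Set.mem_singleton_iff] at hy hy'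
    subst hy hy'
    refine cut_eq_of_right hP hi.1 ?_ hj.1 ?_ he
    · simpa [P, FreeMonoid.ofList_cons] using hi.2.1
    · simpa [P, FreeMonoid.ofList_cons] using hj.2.1
  have : Finite c.Quotient := Quotient.finite _
  refine iUnion_mem_UPol hC f ?_ ?_ fun w => ?_
  rotate_left 2
  · constructor
    · rintro ⟨hwq, hwm⟩
      obtain ⟨x, a, y, rfl, hy, hya⟩ := exists_cut_right (P := P) ⟨1, by simp⟩ w (h3 _ hwq)
      refine ⟨⟨⟨α (.ofList y), a, (α (.ofList x) : M)⟩, hy, ?_, ?_⟩, x, ⟨rfl, ?_⟩, y, rfl, rfl⟩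
      · simpa [P, FreeMonoid.ofList_cons] using hya
      · rw [← hwq]
        simp [FreeMonoid.ofList_append, FreeMonoid.ofList_cons]
      · rw [← hwm]
        simp [FreeMonoid.ofList_append, FreeMonoid.ofList_cons, mul_assoc]
    · rintro ⟨⟨⟨m₁, a, q₂⟩, hi⟩, x, ⟨hxq, hxm⟩, y, hy, rfl⟩
      simp only [mem_preimageLanguage, Set.mem_singleton_iff] at hy hxq hxm
      subst hy
      refine ⟨?_, ?_⟩
      · refine Eq.trans ?_ hi.2.2
        subst hxq
        simp [FreeMonoid.ofList_append, FreeMonoid.ofList_cons]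
      · rw [← hxm]
        simp [FreeMonoid.ofList_append, FreeMonoid.ofList_cons, mul_assoc]
  · rintro ⟨⟨m₁, a, q₂⟩, hi⟩
    refine MemUPol.concat (h2 _ _ hi.2.2 hi.2.1) (h1 m₁ ⟨q₂ * α (.of a), ?_⟩ ?_) ?_
    · rw [← hi.2.2, mul_assoc]; rfl
    · intro k l
      rw [← hi.2.2]
      exact h.not_two_sided_of_drop_left hi.1 hi.2.1 q₂ k l
    · intro x _ x' _ y hy y' hy' he
      have := hcut ⟨_, hi⟩ ⟨_, hi⟩ x x' y y' hy hy' he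
      exact ⟨this.1, this.2.2⟩
  · rintro ⟨⟨m₁, a, q₂⟩, hi⟩ ⟨⟨m₁', a', q₂'⟩, hj⟩ w ⟨x, ⟨hx, _⟩, y, hy, rfl⟩
      ⟨x', ⟨hx', _⟩, y', hy', he⟩
    obtain ⟨rfl, rfl, rfl⟩ := hcut ⟨_, hi⟩ ⟨_, hj⟩ x x' y y' hy hy' he.symm
    simp only [mem_preimageLanguage, Set.mem_singleton_iff] at hx hx' hy hy'
    subst hx hx' hy hy'
    rfl

end UPol

/-! ### The equation implies membership in the closure: the double induction -/

section Equation

variable {A : Type u} {C : Set (Language A)} {M : Type u} [Monoid M] {c : Con M} {n : ℕ}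

/-- The number of elements that divide `q` on both sides. -/
noncomputable def divisorCount {N : Type*} [Monoid N] (q : N) : ℕ :=
  Set.ncard {x : N | ∃ k l, k * x * l = q}

theorem divisorCount_le {N : Type*} [Monoid N] [Finite N] {p q : N} (h : ∃ k l, k * p * l = q) :
    divisorCount p ≤ divisorCount q := by
  refine Set.ncard_le_ncard ?_ (Set.toFinite _)
  rintro x ⟨k', l', rfl⟩
  obtain ⟨k, l, rfl⟩ := h
  exact ⟨k * k', l' * l, by simp only [mul_assoc]⟩

theorem divisorCount_lt {N : Type*} [Monoid N] [Finite N] {p q : N} (h : ∃ k l, k * p * l = q)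
    (h' : ∀ k l, k * q * l ≠ p) : divisorCount p < divisorCount q := by
  refine Set.ncard_lt_ncard ⟨?_, fun hle => ?_⟩ (Set.toFinite _)
  · rintro x ⟨k', l', rfl⟩
    obtain ⟨k, l, rfl⟩ := h
    exact ⟨k * k', l' * l, by simp only [mul_assoc]⟩
  · obtain ⟨k, l, hkl⟩ := hle (a := q) ⟨1, 1, by simp⟩
    exact h' k l hkl

theorem ncard_range_mul_lt [Finite M] {s x : M} (h : ¬ ∃ z, s * x * z = s) :
    (Set.range (s * x * ·)).ncard < (Set.range (s * ·)).ncard := by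
  refine Set.ncard_lt_ncard ⟨?_, fun hle => ?_⟩ (Set.toFinite _)
  · rintro _ ⟨z, rfl⟩
    exact ⟨x * z, by simp only [mul_assoc]⟩
  · exact h (hle ⟨1, mul_one s⟩)

theorem ncard_range_mul_right_lt [Finite M] {r x : M} (h : ¬ ∃ z, z * x * r = r) :
    (Set.range (· * (x * r))).ncard < (Set.range (· * r)).ncard := by
  refine Set.ncard_lt_ncard ⟨?_, fun hle => ?_⟩ (Set.toFinite _)
  · rintro _ ⟨z, rfl⟩
    exact ⟨z * x, by simp only [mul_assoc]⟩
  · obtain ⟨z, hz⟩ := hle ⟨1, one_mul r⟩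
    exact h ⟨z, by rw [mul_assoc]; exact hz⟩

theorem contextLanguage_mem_UPol_of_stable (hC : IsPrevariety C)
    (α : FreeMonoid A →* M) (hcl : ∀ a : M, preimageLanguage α {t | c a t} ∈ C)
    (h : IsLocallyTrivialOver c n) (q : c.Quotient) (s r m : M)
    (hq : ∃ k l, k * (s * q * r) * l = q)
    (hs : ∃ a : M, (a : c.Quotient) = q ∧ ∃ z, s * a * z = s)
    (hr : ∃ a : M, (a : c.Quotient) = q ∧ ∃ z, z * a * r = r) :
    contextLanguage α c q s r m ∈ UPol C := by
  obtain ⟨a, rfl, hz⟩ := hs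
  obtain ⟨b, hb, hz'⟩ := hr
  have hz'' := h.exists_mul_left ((Con.eq c).1 hb) hz'
  obtain ⟨k, l, hkl⟩ := hq
  obtain ⟨k, rfl⟩ := Con.mk'_surjective k
  obtain ⟨l, rfl⟩ := Con.mk'_surjective l
  have ha : c (k * (s * a * r) * l) a := (Con.eq c).1 hkl
  have key : ∀ x : M, c a x → s * a * r = s * x * r := fun x hx => h.mul_mul_eq hx hz hz'' ha
  by_cases hm : s * a * r = m
  · refine mem_of_mem_iff (MemUPol.base (hcl a)) fun w => ?_
    rw [mem_contextLanguage, Con.eq]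
    exact ⟨fun hw => c.symm hw.1, fun hw => ⟨c.symm hw, by rw [← key _ hw, hm]⟩⟩
  · refine mem_of_mem_iff (MemUPol.base hC.empty_mem) fun w => ?_
    rw [mem_contextLanguage, Con.eq]
    exact ⟨fun hw => (hm (by rw [key _ (c.symm hw.1), hw.2])).elim, False.elim⟩

theorem contextLanguage_mem_UPol_of_preimage [Finite M] (hC : IsPrevariety C)
    (α : FreeMonoid A →* M) (q : c.Quotient) (s r m : M)
    (h : ∀ a : M, (a : c.Quotient) = q → preimageLanguage α {a} ∈ UPol C) :
    contextLanguage α c q s r m ∈ UPol C := by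
  refine iUnion_mem_UPol hC (ι := {a : M // (a : c.Quotient) = q ∧ s * a * r = m})
    (fun a => preimageLanguage α {a.1}) (fun a => h a a.2.1) ?_ ?_
  · rintro a b w ha hb
    exact Subtype.ext (ha.symm.trans hb)
  · intro w
    exact ⟨fun hw => ⟨⟨_, hw⟩, rfl⟩, fun ⟨a, ha⟩ => by
      have : α (.ofList w) = a := ha
      rw [mem_contextLanguage, this]; exact a.2⟩

/-- Inner induction, with `R` bounding `|sM| + |Mr|`; `ih` is the outer hypothesis. The invariant
that `q` is recovered from `s * q * r` is what the stable case needs. -/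
theorem preimageLanguage_mem_UPol_of_lt [Finite A] [Finite M] (hC : IsPrevariety C)
    (α : FreeMonoid A →* M) (hcl : ∀ a : M, preimageLanguage α {t | c a t} ∈ C)
    (h : IsLocallyTrivialOver c n) (N : ℕ)
    (ih : ∀ a : M, divisorCount (a : c.Quotient) < N → preimageLanguage α {a} ∈ UPol C)
    (R : ℕ) : ∀ (q : c.Quotient) (s r m : M), divisorCount q ≤ N →
      (∃ k l, k * (s * q * r) * l = q) →
      (Set.range (s * ·)).ncard + (Set.range (· * r)).ncard < R →
      contextLanguage α c q s r m ∈ UPol C := by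
  have : Finite c.Quotient := Quotient.finite _
  induction R with
  | zero => intro _ _ _ _ _ _ h; exact (Nat.not_lt_zero _ h).elim
  | succ R ihR =>
    intro q s r m hqN hq hR
    obtain ⟨k, l, hkl⟩ := hq
    -- a factor of `q` is either smaller, or two-sided equivalent to `q`
    have step : ∀ (p : c.Quotient) (s' r' : M), (s * q * r : c.Quotient) = s' * p * r' →
        (∃ k l, k * p * l = q) →
        (Set.range (s' * ·)).ncard + (Set.range (· * r')).ncard < R →
        contextLanguage α c p s' r' m ∈ UPol C := by
      intro p s' r' he hp hR'
      -- If `q` also divides `p`, the invariant passes from `q` to `p` and the inner induction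
      -- applies. If not, `p` has strictly fewer divisors, and the language is a finite union of
      -- preimages of elements covered by `ih`.
      by_cases hpq : ∃ k l, k * q * l = p
      · refine ihR p s' r' m ((divisorCount_le hp).trans hqN) ?_ hR'
        obtain ⟨k', l', rfl⟩ := hpq
        refine ⟨k' * k, l * l', ?_⟩
        rw [← he]
        nth_rw 2 [← hkl]
        simp only [mul_assoc]
      · refine contextLanguage_mem_UPol_of_preimage hC α p s' r' m fun a ha => ih a ?_
        rw [ha]
        refine (divisorCount_lt hp fun k l he => hpq ⟨k, l, he⟩).trans_le hqN
    by_cases hs : ∃ a : M, (a : c.Quotient) = q ∧ ∃ z, s * a * z = s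
    · by_cases hr : ∃ a : M, (a : c.Quotient) = q ∧ ∃ z, z * a * r = r
      · exact contextLanguage_mem_UPol_of_stable hC α hcl h q s r m ⟨k, l, hkl⟩ hs hr
      · refine contextLanguage_mem_UPol_of_drop_left hC α h q s r m ?_ ?_
          fun a ha hz => hr ⟨a, ha, hz⟩
        · rintro a ⟨y, hy⟩ hlt
          exact ih a ((divisorCount_lt ⟨y, 1, by rw [mul_one, hy]⟩ hlt).trans_le hqN)
        · intro x p hpx hd
          refine step p s (x * r) ?_ ⟨1, x, by rw [one_mul, hpx]⟩ ?_
          · rw [← hpx]; simp only [Con.coe_mul, mul_assoc]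
          · have := ncard_range_mul_right_lt hd
            omega
    · refine contextLanguage_mem_UPol_of_drop_right hC α h q s r m ?_ ?_
          fun a ha hz => hs ⟨a, ha, hz⟩
      · rintro a ⟨y, hy⟩ hlt
        exact ih a ((divisorCount_lt ⟨1, y, by rw [one_mul, hy]⟩ hlt).trans_le hqN)
      · intro x p hpx hd
        refine step p (s * x) r ?_ ⟨x, 1, by rw [mul_one, hpx]⟩ ?_
        · rw [← hpx]; simp only [Con.coe_mul, mul_assoc]
        · have := ncard_range_mul_lt hd
          omega

theorem preimageLanguage_mem_UPol [Finite A] [Finite M] (hC : IsPrevariety C)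
    (α : FreeMonoid A →* M) (hcl : ∀ a : M, preimageLanguage α {t | c a t} ∈ C)
    (h : IsLocallyTrivialOver c n) (F : Set M) : preimageLanguage α F ∈ UPol C := by
  have key : ∀ (N : ℕ) (a : M), divisorCount (a : c.Quotient) < N →
      preimageLanguage α {a} ∈ UPol C := by
    intro N
    induction N with
    | zero => intro a ha; exact (Nat.not_lt_zero _ ha).elim
    | succ N ih =>
      intro a ha
      -- With trivial contexts `s = r = 1` and `m = a`, the context language is exactly the preimage
      -- of `a`.
      refine mem_of_mem_iff (preimageLanguage_mem_UPol_of_lt hC α hcl h N ih _ a 1 1 a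
        (Nat.lt_succ_iff.1 ha) ⟨1, 1, by simp⟩ (Nat.lt_succ_self _)) fun w => ?_
      rw [mem_contextLanguage, one_mul, mul_one]
      exact ⟨fun hw => ⟨congrArg _ hw, hw⟩, fun hw => hw.2⟩
  refine iUnion_mem_UPol hC (fun a : F => preimageLanguage α {a.1})
    (fun a => key _ _ (Nat.lt_succ_self _)) (fun a b w ha hb => Subtype.ext (ha.symm.trans hb))
    fun w => ⟨fun hw => ⟨⟨_, hw⟩, rfl⟩, ?_⟩
  rintro ⟨a, ha⟩
  have : α (.ofList w) = a := ha
  rw [mem_preimageLanguage, this]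
  exact a.2

theorem mem_UPol_of_equation [Finite A] (hC : IsPrevariety C) {L : Language A}
    (hL : L.IsRegular) (h : SatisfiesUPolEquation C (syntacticMorphism L)) : L ∈ UPol C := by
  have := finite_syntacticCon_quotient hL
  have hω := omega_spec (syntacticCon L).Quotient
  have hloc : IsLocallyTrivialOver
      (canonicalCon hC (syntacticMorphism L) (syntacticMorphism_surjective L))
      (omega (syntacticCon L).Quotient) := ⟨hω.1, hω.2, h⟩
  rw [← preimageLanguage_syntacticImage L]
  exact preimageLanguage_mem_UPol hC _ (hC.canonical_class_mem _) hloc _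

end Equation

/-! ### Languages of the closure satisfy the equation -/

section Necessity

theorem pow_add_mul_period {M : Type*} [Monoid M] {s : M} {c d : ℕ} (h : s ^ (c + d) = s ^ c)
    {i : ℕ} (hi : c ≤ i) (k : ℕ) : s ^ (i + k * d) = s ^ i := by
  induction k with
  | zero => simp
  | succ k ih =>
    obtain ⟨j, rfl⟩ := Nat.exists_eq_add_of_le hi
    have : c + j + (k + 1) * d = (c + d) + (j + k * d) := by ring
    rw [this, pow_add, h, ← pow_add, ← add_assoc, ih]

variable {A : Type u}

theorem mem_markedConcat_iff {K L : Language A} {a : A} {w : FreeMonoid A} :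
    w.toList ∈ markedConcat K a L ↔
      ∃ q r : FreeMonoid A, w = q * .of a * r ∧ q.toList ∈ K ∧ r.toList ∈ L := by
  constructor
  · rintro ⟨x, hx, y, hy, he⟩
    refine ⟨.ofList x, .ofList y, ?_, hx, hy⟩
    apply FreeMonoid.toList.injective
    simpa using he.symm
  · rintro ⟨q, r, rfl, hq, hr⟩
    exact ⟨_, hq, _, hr, by simp⟩

theorem mul_eq_cut_iff {x y q r : FreeMonoid A} {a : A} :
    x * y = q * .of a * r ↔
      (∃ z, x = q * .of a * z ∧ r = z * y) ∨ ∃ z, y = z * .of a * r ∧ q = x * z := by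
  constructor
  · intro h
    have h' := congrArg FreeMonoid.toList h
    simp only [FreeMonoid.toList_mul, FreeMonoid.toList_of, List.append_assoc,
      List.singleton_append] at h'
    rw [List.append_eq_append_iff] at h'
    rcases h' with ⟨z, hz, hz'⟩ | ⟨z, hz, hz'⟩
    · refine .inr ⟨.ofList z, ?_, ?_⟩
      · apply FreeMonoid.toList.injective; simpa using hz'
      · apply FreeMonoid.toList.injective; simpa using hz
    · cases z with
      | nil =>
        refine .inr ⟨1, ?_, ?_⟩
        · apply FreeMonoid.toList.injective; simpa using hz'.symm
        · apply FreeMonoid.toList.injective; simpa using hz.symm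
      | cons b z =>
        obtain ⟨rfl, hr⟩ : a = b ∧ r.toList = z ++ y.toList := by simpa using hz'
        refine .inl ⟨.ofList z, ?_, ?_⟩
        · apply FreeMonoid.toList.injective; simpa using hz
        · apply FreeMonoid.toList.injective; simpa using hr
  · rintro (⟨z, rfl, rfl⟩ | ⟨z, rfl, rfl⟩) <;> simp only [mul_assoc]

theorem pow_eq_cut {u q r : FreeMonoid A} {a : A} {p : ℕ} (h : u ^ p = q * .of a * r) :
    ∃ i j q' r', i + 1 + j = p ∧ u = q' * .of a * r' ∧ q = u ^ i * q' ∧ r = r' * u ^ j := by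
  induction p generalizing q with
  | zero =>
    have := congrArg FreeMonoid.length h
    simp [FreeMonoid.length] at this
  | succ p ih =>
    rw [pow_succ', mul_eq_cut_iff] at h
    rcases h with ⟨z, hz, rfl⟩ | ⟨z, hz, rfl⟩
    · exact ⟨0, p, q, z, by omega, hz, by simp, rfl⟩
    · obtain ⟨i, j, q', r', hij, hu, rfl, rfl⟩ := ih hz
      exact ⟨i + 1, j, q', r', by omega, hu, by rw [pow_succ', mul_assoc], rfl⟩

/-- The word `x q a r m q a r y` could be cut at either displayed `a`. -/
theorem IsUnambiguous.not_two_cuts {K L : Language A} {a : A} (h : IsUnambiguous K a L)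
    {x q r m y : FreeMonoid A} (h1 : (x * q).toList ∈ K) (h2 : (r * y).toList ∈ L)
    (h3 : (x * ((q * .of a * r) * m) * q).toList ∈ K)
    (h4 : (r * (m * (q * .of a * r)) * y).toList ∈ L) : False := by
  have := h _ h1 _ h3 _ h4 _ h2 (by simp)
  have := congrArg List.length this.1
  simp at this

/-- The words identified by `g` satisfy, up to the syntactic congruence of `L`, the equation
`u ^ n * v * u ^ n = u ^ (n + 1 + n)`, and `n`-th powers are idempotent. -/
structure SatisfiesPowerEquation {N : Type u} [Monoid N] (g : FreeMonoid A →* N) (n : ℕ)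
    (L : Language A) : Prop where
  period : ∀ u, syntacticMorphism L u ^ (n + n) = syntacticMorphism L u ^ n
  eqn : ∀ u v, g u = g v → ∀ i j, n ≤ i → n ≤ j →
    syntacticMorphism L u ^ i * syntacticMorphism L v * syntacticMorphism L u ^ j =
      syntacticMorphism L u ^ (i + 1 + j)

section

variable {N : Type u} [Monoid N] {g : FreeMonoid A →* N} {n : ℕ} {K L : Language A}

theorem SatisfiesPowerEquation.of_eqn
    (h1 : ∀ u, syntacticMorphism L u ^ (n + n) = syntacticMorphism L u ^ n)
    (h2 : ∀ u v, g u = g v →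
      syntacticMorphism L u ^ n * syntacticMorphism L v * syntacticMorphism L u ^ n =
        syntacticMorphism L u ^ (n + 1 + n)) : SatisfiesPowerEquation g n L := by
  refine ⟨h1, fun u v huv i j hi hj => ?_⟩
  obtain ⟨i, rfl⟩ := Nat.exists_eq_add_of_le' hi
  obtain ⟨j, rfl⟩ := Nat.exists_eq_add_of_le hj
  have : i + n + 1 + (n + j) = i + ((n + 1 + n) + j) := by omega
  rw [this, pow_add _ i (n + 1 + n + j), pow_add _ (n + 1 + n) j, ← h2 u v huv, pow_add, pow_add]
  simp only [mul_assoc]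

theorem SatisfiesPowerEquation.mono (h : SatisfiesPowerEquation g n L) {N' : Type u} [Monoid N']
    {g' : FreeMonoid A →* N'} (hg : ∀ u v, g' u = g' v → g u = g v) {k : ℕ} (hk : 0 < k) :
    SatisfiesPowerEquation g' (n * k) L where
  period u := by
    have hn : n ≤ n * k := Nat.le_mul_of_pos_right n hk
    have := pow_add_mul_period (h.period u) hn k
    rwa [mul_comm k n] at this
  eqn u v huv i j hi hj := h.eqn u v (hg u v huv) i j
    ((Nat.le_mul_of_pos_right n hk).trans hi) ((Nat.le_mul_of_pos_right n hk).trans hj)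

theorem syntacticCon_sup {v w : FreeMonoid A} (hK : syntacticCon K v w)
    (hL : syntacticCon L v w) : syntacticCon (K ⊔ L) v w :=
  fun x y => or_congr (hK x y) (hL x y)

theorem SatisfiesPowerEquation.sup (hK : SatisfiesPowerEquation g n K)
    (hL : SatisfiesPowerEquation g n L) : SatisfiesPowerEquation g n (K ⊔ L) where
  period u := by
    have h1 := hK.period u
    have h2 := hL.period u
    simp only [← map_pow, syntacticMorphism_eq_iff] at h1 h2 ⊢
    exact syntacticCon_sup h1 h2
  eqn u v huv i j hi hj := by
    have h1 := hK.eqn u v huv i j hi hj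
    have h2 := hL.eqn u v huv i j hi hj
    simp only [← map_pow, ← map_mul, syntacticMorphism_eq_iff] at h1 h2 ⊢
    exact syntacticCon_sup h1 h2

theorem SatisfiesPowerEquation.pow_eq (h : SatisfiesPowerEquation g n L) (u : FreeMonoid A)
    {i j k : ℕ} (hi : n ≤ i) (hj : j = i + k * n) :
    syntacticMorphism L u ^ j = syntacticMorphism L u ^ i := by
  rw [hj, pow_add_mul_period (h.period u) hi]

theorem IsUnambiguous.not_cut_pow {a : A} (h : IsUnambiguous K a L)
    (hK : SatisfiesPowerEquation g n K) (hL : SatisfiesPowerEquation g n L) (hn : 0 < n)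
    {x y q r : FreeMonoid A} {i j : ℕ} (hi : n ≤ i) (hj : n ≤ j)
    (h1 : (x * (q * .of a * r) ^ i * q).toList ∈ K)
    (h2 : (r * ((q * .of a * r) ^ j * y)).toList ∈ L) : False := by
  generalize hu : q * .of a * r = u at h1 h2
  refine h.not_two_cuts (m := u ^ (n - 1)) h1 h2 ?_ ?_
  · have h3 : syntacticMorphism K (u ^ i) = syntacticMorphism K (u ^ i * u * u ^ (n - 1)) := by
      rw [← pow_succ, ← pow_add, map_pow, map_pow, hK.pow_eq u hi (j := i + 1 + (n - 1)) (k := 1) (by omega)]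
    simpa only [hu, mul_assoc] using (mem_of_syntacticMorphism_eq h3 x q).1 h1
  · have h3 : syntacticMorphism L (u ^ j) = syntacticMorphism L (u ^ (n - 1) * u * u ^ j) := by
      rw [← pow_succ, ← pow_add, map_pow, map_pow, hL.pow_eq u hj (j := n - 1 + 1 + j) (k := 1) (by omega)]
    simpa only [hu, mul_assoc] using (mem_of_syntacticMorphism_eq h3 r y).1
      (by simpa only [mul_assoc] using h2)

/-- Here the cut lies inside `v = q a r`. Inserting `v * u ^ (2 * n - 1)` after `u ^ i`, or `u ^ (2
* n - 1) * v` before `u ^ j`, amounts by the equation to adding `2 * n` factors `u`, which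
periodicity hides. -/
theorem IsUnambiguous.not_cut_middle {a : A} (h : IsUnambiguous K a L)
    (hK : SatisfiesPowerEquation g n K) (hL : SatisfiesPowerEquation g n L) (hn : 0 < n)
    {x y q r u : FreeMonoid A} (huv : g u = g (q * .of a * r)) {i j : ℕ} (hi : n ≤ i) (hj : n ≤ j)
    (h1 : (x * u ^ i * q).toList ∈ K) (h2 : (r * (u ^ j * y)).toList ∈ L) : False := by
  generalize hv : q * .of a * r = v at huv
  refine h.not_two_cuts (m := u ^ (2 * n - 1)) h1 h2 ?_ ?_
  · have h3 := hK.eqn u v huv i (2 * n - 1) hi (by omega)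
    rw [hK.pow_eq u hi (j := i + 1 + (2 * n - 1)) (k := 2) (by omega)] at h3
    simp only [← map_pow, ← map_mul] at h3
    simpa only [hv, mul_assoc] using (mem_of_syntacticMorphism_eq h3 x q).2 h1
  · have h3 := hL.eqn u v huv (2 * n - 1) j (by omega) hj
    rw [hL.pow_eq u hj (j := 2 * n - 1 + 1 + j) (k := 2) (by omega)] at h3
    simp only [← map_pow, ← map_mul] at h3
    simpa only [hv, mul_assoc] using (mem_of_syntacticMorphism_eq h3 r y).2
      (by simpa only [mul_assoc] using h2)

theorem exists_le_add_eq_mul (hn : 0 < n) (i : ℕ) : ∃ M k, n ≤ M ∧ M + i = k * n := by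
  refine ⟨(i + 1) * n - i, i + 1, ?_, ?_⟩
  · have : i ≤ i * n := Nat.le_mul_of_pos_right i hn
    rw [add_mul]
    omega
  · have : i ≤ i * n := Nat.le_mul_of_pos_right i hn
    rw [add_mul]
    omega

theorem IsUnambiguous.not_cut_right {a : A} (h : IsUnambiguous K a L)
    (hK : SatisfiesPowerEquation g n K) (hL : SatisfiesPowerEquation g n L) (hn : 0 < n)
    {x y q r v : FreeMonoid A} (huv : g (q * .of a * r) = g v) {p i j : ℕ} (hp : n ≤ p)
    (hj : n ≤ j) (h1 : (x * (q * .of a * r) ^ p * v * (q * .of a * r) ^ i * q).toList ∈ K)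
    (h2 : (r * ((q * .of a * r) ^ j * y)).toList ∈ L) : False := by
  generalize hu : q * .of a * r = u at *
  -- The loop inserted at the cut contains `v` and one factor `u = q a r`; these two and the `i`
  -- further factors are completed by `M` to a multiple of the period `n`.
  obtain ⟨M, k, hM, hk⟩ := exists_le_add_eq_mul hn (i + 2)
  refine h.not_two_cuts (x := x * u ^ p * v * u ^ i) (m := u ^ M * v * u ^ i) h1 h2 ?_ ?_
  · have h3 := hK.eqn u v huv p (i + 1 + M) hp (by omega)
    rw [hK.pow_eq u hp (j := p + 1 + (i + 1 + M)) (k := k) (by omega)] at h3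
    simp only [← map_pow, ← map_mul] at h3
    have h4 := (mem_of_syntacticMorphism_eq h3 x (v * u ^ i * q)).2
      (by simpa only [mul_assoc] using h1)
    simpa only [hu, mul_assoc, pow_add, pow_one] using h4
  · have h3 := hL.eqn u v huv M (i + 1 + j) hM (by omega)
    rw [hL.pow_eq u hj (j := M + 1 + (i + 1 + j)) (k := k) (by omega)] at h3
    simp only [← map_pow, ← map_mul] at h3
    have h4 := (mem_of_syntacticMorphism_eq h3 r y).2 (by simpa only [mul_assoc] using h2)
    simpa only [hu, mul_assoc, pow_add, pow_one] using h4

theorem IsUnambiguous.not_cut_left {a : A} (h : IsUnambiguous K a L)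
    (hK : SatisfiesPowerEquation g n K) (hL : SatisfiesPowerEquation g n L) (hn : 0 < n)
    {x y q r v : FreeMonoid A} (huv : g (q * .of a * r) = g v) {p i j : ℕ} (hp : n ≤ p)
    (hi : n ≤ i) (h1 : (x * (q * .of a * r) ^ i * q).toList ∈ K)
    (h2 : (r * ((q * .of a * r) ^ j * v * (q * .of a * r) ^ p * y)).toList ∈ L) : False := by
  generalize hu : q * .of a * r = u at *
  obtain ⟨M, k, hM, hk⟩ := exists_le_add_eq_mul hn (j + 2)
  refine h.not_two_cuts (y := u ^ j * v * u ^ p * y) (m := u ^ j * v * u ^ M) h1 h2 ?_ ?_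
  · have h3 := hK.eqn u v huv (i + 1 + j) M (by omega) hM
    rw [hK.pow_eq u hi (j := i + 1 + j + 1 + M) (k := k) (by omega)] at h3
    simp only [← map_pow, ← map_mul] at h3
    have h4 := (mem_of_syntacticMorphism_eq h3 x q).2 h1
    simpa only [hu, mul_assoc, pow_add, pow_one] using h4
  · have h3 := hL.eqn u v huv (M + 1 + j) p (by omega) hp
    rw [hL.pow_eq u hp (j := M + 1 + j + 1 + p) (k := k) (by omega)] at h3
    simp only [← map_pow, ← map_mul] at h3
    have h4 := (mem_of_syntacticMorphism_eq h3 (r * u ^ j * v) y).2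
      (by simpa only [mul_assoc] using h2)
    simpa only [hu, mul_assoc, pow_add, pow_one] using h4

theorem cut_mem_markedConcat {a : A} {w q r : FreeMonoid A} (hq : q.toList ∈ K)
    (hr : r.toList ∈ L) (h : w = q * .of a * r) : w.toList ∈ markedConcat K a L :=
  mem_markedConcat_iff.2 ⟨q, r, h, hq, hr⟩

/-- The cases follow the position of the marked letter. A cut in the context, or close enough to an
end of the powers, leaves one factor with a long block to which its own equation applies; any other
cut contradicts unambiguity. The exponent `2 * n` ensures that a cut fewer than `n` factors from an
end still leaves `n` factors on each side of `v`. -/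
theorem IsUnambiguous.syntacticCon_markedConcat {a : A} (h : IsUnambiguous K a L)
    (hK : SatisfiesPowerEquation g n K) (hL : SatisfiesPowerEquation g n L) (hn : 0 < n)
    {u v : FreeMonoid A} (huv : g u = g v) :
    syntacticCon (markedConcat K a L) (u ^ (2 * n) * v * u ^ (2 * n))
      (u ^ (2 * n + 1 + 2 * n)) := by
  intro x y
  have hK' := hK.eqn u v huv (2 * n) (2 * n) (by omega) (by omega)
  have hL' := hL.eqn u v huv (2 * n) (2 * n) (by omega) (by omega)
  simp only [← map_mul, ← map_pow] at hK' hL'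
  constructor
  · rw [mem_markedConcat_iff]
    rintro ⟨q, r, he, hq, hr⟩
    rw [mul_eq_cut_iff] at he
    rcases he with ⟨z, he, rfl⟩ | ⟨z, rfl, rfl⟩
    · rw [mul_eq_cut_iff] at he
      rcases he with ⟨z, rfl, rfl⟩ | ⟨q, he, rfl⟩
      · refine cut_mem_markedConcat (r := z * u ^ (2 * n + 1 + 2 * n) * y) hq
          ((mem_of_syntacticMorphism_eq hL' _ _).1 hr) (by simp only [mul_assoc])
      · rw [mul_eq_cut_iff] at he
        rcases he with ⟨r, he, rfl⟩ | ⟨q, he, rfl⟩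
        · rw [mul_eq_cut_iff] at he
          rcases he with ⟨r, he, rfl⟩ | ⟨q, rfl, rfl⟩
          · obtain ⟨i, j, q, r, hij, rfl, rfl, rfl⟩ := pow_eq_cut he
            by_cases hi : n ≤ i
            · exact (h.not_cut_left hK hL hn huv (p := 2 * n) (y := y) (x := x) (j := j)
                (by omega) hi (by simpa only [mul_assoc] using hq)
                (by simpa only [mul_assoc] using hr)).elim
            · have h3 := hL.eqn _ v huv j (2 * n) (by omega) (by omega)
              simp only [← map_mul, ← map_pow] at h3
              refine cut_mem_markedConcat hq ((mem_of_syntacticMorphism_eq h3 r y).1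
                (by simpa only [mul_assoc] using hr)) ?_
              have : 2 * n + 1 + 2 * n = i + 1 + (j + 1 + 2 * n) := by omega
              rw [this, pow_add _ (i + 1), pow_succ]
              simp only [mul_assoc]
          · exact (h.not_cut_middle hK hL hn huv (i := 2 * n) (j := 2 * n) (x := x) (y := y)
              (by omega) (by omega) (by simpa only [mul_assoc] using hq)
              (by simpa only [mul_assoc] using hr)).elim
        · obtain ⟨i, j, q, r, hij, rfl, rfl, rfl⟩ := pow_eq_cut he
          by_cases hj : n ≤ j
          · exact (h.not_cut_right hK hL hn huv (p := 2 * n) (y := y) (x := x) (i := i)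
              (by omega) hj (by simpa only [mul_assoc] using hq)
              (by simpa only [mul_assoc] using hr)).elim
          · have h3 := hK.eqn _ v huv (2 * n) i (by omega) (by omega)
            simp only [← map_mul, ← map_pow] at h3
            refine cut_mem_markedConcat ((mem_of_syntacticMorphism_eq h3 x q).1
                (by simpa only [mul_assoc] using hq)) hr ?_
            have : 2 * n + 1 + 2 * n = (2 * n + 1 + i) + 1 + j := by omega
            rw [this, pow_add _ (2 * n + 1 + i + 1), pow_succ _ (2 * n + 1 + i)]
            simp only [mul_assoc]
    · exact cut_mem_markedConcat ((mem_of_syntacticMorphism_eq hK' _ _).1 hq) hr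
        (by simp only [mul_assoc])
  · rw [mem_markedConcat_iff]
    rintro ⟨q, r, he, hq, hr⟩
    rw [mul_eq_cut_iff] at he
    rcases he with ⟨z, he, rfl⟩ | ⟨z, rfl, rfl⟩
    · rw [mul_eq_cut_iff] at he
      rcases he with ⟨z, rfl, rfl⟩ | ⟨q, he, rfl⟩
      · refine cut_mem_markedConcat (r := z * (u ^ (2 * n) * v * u ^ (2 * n)) * y) hq
          ((mem_of_syntacticMorphism_eq hL' _ _).2 hr) (by simp only [mul_assoc])
      · obtain ⟨i, j, q, r, hij, rfl, rfl, rfl⟩ := pow_eq_cut he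
        by_cases hi : n ≤ i
        · by_cases hj : n ≤ j
          · exact (h.not_cut_pow hK hL hn (x := x) (y := y) hi hj
              (by simpa only [mul_assoc] using hq) (by simpa only [mul_assoc] using hr)).elim
          -- From `i + 1 + j = 4 * n + 1` and `j < n` it follows that `i ≥ 3 * n + 1`, so the
          -- exponent after `v` is at least `n`.
          · have h3 := hK.eqn _ v huv (2 * n) (i - (2 * n + 1)) (by omega) (by omega)
            rw [show 2 * n + 1 + (i - (2 * n + 1)) = i by omega] at h3
            simp only [← map_mul, ← map_pow] at h3
            refine cut_mem_markedConcat ((mem_of_syntacticMorphism_eq h3 x q).2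
                (by simpa only [mul_assoc] using hq)) hr ?_
            rw [show (q * .of a * r) ^ (2 * n) * v * (q * .of a * r) ^ (2 * n) =
              (q * .of a * r) ^ (2 * n) * v * (q * .of a * r) ^ ((i - (2 * n + 1)) + 1 + j) by
                congr 2; omega, pow_add _ (_ + 1), pow_succ _ (i - (2 * n + 1))]
            simp only [mul_assoc]
        · have h3 := hL.eqn _ v huv (j - (2 * n + 1)) (2 * n) (by omega) (by omega)
          rw [show j - (2 * n + 1) + 1 + 2 * n = j by omega] at h3
          simp only [← map_mul, ← map_pow] at h3
          refine cut_mem_markedConcat hq ((mem_of_syntacticMorphism_eq h3 r y).2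
                (by simpa only [mul_assoc] using hr)) ?_
          rw [show (q * .of a * r) ^ (2 * n) * v * (q * .of a * r) ^ (2 * n) =
              (q * .of a * r) ^ (i + 1 + (j - (2 * n + 1))) * v * (q * .of a * r) ^ (2 * n) by
                congr 3; omega, pow_add _ (i + 1), pow_succ _ i]
          simp only [mul_assoc]
    · exact cut_mem_markedConcat ((mem_of_syntacticMorphism_eq hK' _ _).2 hq) hr
        (by simp only [mul_assoc])

theorem SatisfiesPowerEquation.markedConcat {a : A} (h : IsUnambiguous K a L)
    (hK : SatisfiesPowerEquation g n K) (hL : SatisfiesPowerEquation g n L) (hn : 0 < n)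
    (hg : ∀ p : N, p ^ (n + n) = p ^ n) :
    ∃ n', 0 < n' ∧ SatisfiesPowerEquation g n' (markedConcat K a L) := by
  set H := UnambiguousPolynomialClosure.markedConcat K a L with hH
  have key : ∀ u v, g u = g v →
      syntacticMorphism H u ^ (2 * n) * syntacticMorphism H v * syntacticMorphism H u ^ (2 * n) =
        syntacticMorphism H u ^ (2 * n + 1 + 2 * n) := by
    intro u v huv
    simp only [← map_mul, ← map_pow, syntacticMorphism_eq_iff]
    exact h.syntacticCon_markedConcat hK hL hn huv
  -- Periodicity comes from the equation itself: `u ^ (n + 1)` and `u ^ (n + 1 + n)` have the same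
  -- image under `g`, and `key` for this pair equates the powers of `u` with exponents `c + n` and
  -- `c`.
  set c := (n + 1) * (2 * n + 1 + 2 * n) with hc
  have hcn : ∀ u, syntacticMorphism H u ^ (c + n) = syntacticMorphism H u ^ c := by
    intro u
    have h1 := key (u ^ (n + 1)) (u ^ (n + 1 + n)) (by
      simp only [map_pow]
      rw [add_right_comm, pow_succ, pow_succ, hg])
    simp only [map_pow, ← pow_mul, ← pow_add] at h1
    rw [hc, ← h1]
    congr 1
    ring
  have hcle : 2 * n ≤ c := by nlinarith
  have hle : c ≤ n * c := Nat.le_mul_of_pos_left c hn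
  refine ⟨n * c, by positivity, fun u => ?_, fun u v huv i j hi hj => ?_⟩
  · have := pow_add_mul_period (hcn u) hle c
    rwa [mul_comm c n] at this
  · obtain ⟨i, rfl⟩ := Nat.exists_eq_add_of_le' (hcle.trans (hle.trans hi))
    obtain ⟨j, rfl⟩ := Nat.exists_eq_add_of_le (hcle.trans (hle.trans hj))
    have : i + 2 * n + 1 + (2 * n + j) = i + ((2 * n + 1 + 2 * n) + j) := by omega
    rw [this, pow_add _ i (2 * n + 1 + 2 * n + j), pow_add _ (2 * n + 1 + 2 * n) j, ← key u v huv,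
      pow_add, pow_add _ (2 * n)]
    simp only [mul_assoc]

end

theorem exists_satisfiesPowerEquation_of_mem [Finite A] {C : Set (Language A)}
    (hC : IsPrevariety C) {L : Language A} (hL : L ∈ UPol C) :
    ∃ (N : Type u) (_ : Monoid N) (_ : Finite N) (g : FreeMonoid A →* N) (n : ℕ),
      (∀ p : N, preimageLanguage g {p} ∈ C) ∧ (∀ p : N, p ^ (n + n) = p ^ n) ∧ 0 < n ∧
        SatisfiesPowerEquation g n L := by
  -- both factors of an operation can be given the same morphism and exponent
  have merge : ∀ K L : Language A,
      (∃ (N : Type u) (_ : Monoid N) (_ : Finite N) (g : FreeMonoid A →* N) (n : ℕ),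
      (∀ p : N, preimageLanguage g {p} ∈ C) ∧ (∀ p : N, p ^ (n + n) = p ^ n) ∧ 0 < n ∧
        SatisfiesPowerEquation g n K) →
      (∃ (N : Type u) (_ : Monoid N) (_ : Finite N) (g : FreeMonoid A →* N) (n : ℕ),
      (∀ p : N, preimageLanguage g {p} ∈ C) ∧ (∀ p : N, p ^ (n + n) = p ^ n) ∧ 0 < n ∧
        SatisfiesPowerEquation g n L) →
      ∃ (N : Type u) (_ : Monoid N) (_ : Finite N) (g : FreeMonoid A →* N) (n : ℕ),
      (∀ p : N, preimageLanguage g {p} ∈ C) ∧ (∀ p : N, p ^ (n + n) = p ^ n) ∧ 0 < n ∧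
        SatisfiesPowerEquation g n K ∧ SatisfiesPowerEquation g n L := by
    rintro K L ⟨N, _, _, g, n, hg, hgn, hn, hK⟩ ⟨N', _, _, g', n', hg', hgn', hn', hL⟩
    refine ⟨N × N', inferInstance, inferInstance, g.prod g', n * n', ?_, ?_,
      Nat.mul_pos hn hn', hK.mono (fun u v h => congrArg Prod.fst h) hn', ?_⟩
    · rintro ⟨p, p'⟩
      refine mem_of_mem_iff (hC.inter_mem _ (hg p) _ (hg' p')) fun w => ?_
      exact Prod.ext_iff
    · rintro ⟨p, p'⟩
      have h1 := pow_add_mul_period (hgn p) (Nat.le_mul_of_pos_right n hn') n'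
      have h2 := pow_add_mul_period (hgn' p') (Nat.le_mul_of_pos_left n' hn) n
      rw [mul_comm n' n] at h1
      exact Prod.ext h1 h2
    · rw [mul_comm n n']
      exact hL.mono (fun u v h => congrArg Prod.snd h) hn
  induction hL with
  | @base L hL =>
    have := finite_syntacticCon_quotient (hC.regular L hL)
    set φ := syntacticMorphism L with hφ
    have hsurj := syntacticMorphism_surjective L
    set c := canonicalCon hC φ hsurj with hc
    have hω := omega_spec (syntacticCon L).Quotient
    set n := omega (syntacticCon L).Quotient
    have hp : ∀ s : (syntacticCon L).Quotient, s ^ (n + n) = s ^ n := fun s => by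
      rw [pow_add]; exact hω.2 s
    refine ⟨c.Quotient, inferInstance, Quotient.finite _, c.mk'.comp φ, n, ?_, ?_, hω.1,
      .of_eqn (fun u => hp _) fun u v huv => ?_⟩
    · intro p
      obtain ⟨p, rfl⟩ := Con.mk'_surjective p
      refine mem_of_mem_iff (hC.canonical_class_mem φ p) fun w => ?_
      exact eq_comm.trans (Con.eq c)
    · intro p
      obtain ⟨p, rfl⟩ := Con.mk'_surjective p
      rw [← map_pow, ← map_pow, hp]
    · have hcuv : c (φ u) (φ v) := (Con.eq c).1 huv
      -- As `L` itself is in `C`, canonical equivalence tests every context for membership in `L`;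
      -- words with equivalent images are thus syntactically congruent, and the equation is trivial.
      have : φ u = φ v := by
        rw [syntacticMorphism_eq_iff]
        intro x y
        have h1 := c.mul (c.mul (c.refl (φ x)) hcuv) (c.refl (φ y))
        have h2 := h1 (syntacticImage L) (by rwa [preimageLanguage_syntacticImage])
        rwa [← map_mul, ← map_mul, ← map_mul, ← map_mul, mem_syntacticImage,
          mem_syntacticImage] at h2
      rw [← hφ, ← this, ← pow_succ, ← pow_add]
  | @disjoint_union K L _ _ _ ihK ihL =>
    obtain ⟨N, _, _, g, n, hg, hgn, hn, hK, hL⟩ := merge K L ihK ihL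
    exact ⟨N, _, inferInstance, g, n, hg, hgn, hn, hK.sup hL⟩
  | @concat K L a _ _ h ihK ihL =>
    obtain ⟨N, _, _, g, n, hg, hgn, hn, hK, hL⟩ := merge K L ihK ihL
    obtain ⟨n', hn', hH⟩ := SatisfiesPowerEquation.markedConcat h hK hL hn hgn
    have := hH.mono (g' := g) (fun _ _ => id) hn
    refine ⟨N, _, inferInstance, g, n' * n, hg, fun p => ?_, Nat.mul_pos hn' hn, this⟩
    exact pow_add_mul_period (hgn p) (Nat.le_mul_of_pos_left n hn') n'

theorem equation_of_mem_UPol [Finite A] {C : Set (Language A)} (hC : IsPrevariety C)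
    {L : Language A} (hreg : L.IsRegular) (hL : L ∈ UPol C) :
    SatisfiesUPolEquation C (syntacticMorphism L) := by
  have := finite_syntacticCon_quotient hreg
  obtain ⟨N, _, _, g, n, hg, -, hn, h⟩ := exists_satisfiesPowerEquation_of_mem hC hL
  have hω := omega_spec (syntacticCon L).Quotient
  set ω := omega (syntacticCon L).Quotient with hω'
  have key : ∀ u v, g u = g v → syntacticMorphism L u ^ (ω + 1) =
      syntacticMorphism L u ^ ω * syntacticMorphism L v * syntacticMorphism L u ^ ω := by
    intro u v huv
    have h1 : ∀ k, syntacticMorphism L u ^ (ω + k * ω) = syntacticMorphism L u ^ ω := fun k =>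
      pow_add_mul_period (by rw [pow_add]; exact hω.2 _) le_rfl k
    have h2 : n ≤ ω + n * ω := le_add_left (Nat.le_mul_of_pos_right n hω.1)
    have h3 := h.eqn u v huv _ _ h2 h2
    rw [pow_add _ (ω + n * ω + 1) (ω + n * ω), pow_succ, h1, mul_assoc (_ ^ ω) (syntacticMorphism L u),
      ← pow_succ', pow_succ _ ω, ← mul_assoc (_ ^ ω), (hω.2 _).eq, ← pow_succ] at h3
    exact h3.symm
  intro s t hst
  -- Equivalent `s` and `t` need not be images of words identified by `g`. Instead, the set of all
  -- `r` solving the equation with `s` contains `s`; once its preimage is shown to be in `C`, it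
  -- must contain `t`.
  let F : Set (syntacticCon L).Quotient := {r | s ^ (ω + 1) = s ^ ω * r * s ^ ω}
  have hF : preimageLanguage (syntacticMorphism L) F ∈ C := by
    let P : Set N := {p | ∃ v, g v = p ∧ syntacticMorphism L v ∈ F}
    refine hC.iUnion_mem (fun p : P => preimageLanguage g {p.1}) (fun p => hg p) fun w => ?_
    refine ⟨fun hw => ⟨⟨_, .ofList w, rfl, hw⟩, rfl⟩, ?_⟩
    rintro ⟨⟨p, v, hv, hvF⟩, hw⟩
    obtain ⟨z, rfl⟩ := syntacticMorphism_surjective L s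
    have hw : g (.ofList w) = p := hw
    set φ := syntacticMorphism L with hφ
    -- The preimage of `F` is a union of fibres of `g`. Sandwiching `v` and the word `w` between
    -- copies of `z ^ ω` turns the first into an element with image `φ z ^ (ω + 1)`, whose `ω`-th
    -- power is `φ z ^ ω`, so `key` becomes the equation for `w`.
    have h1 := key (z ^ ω * v * z ^ ω) (z ^ ω * .ofList w * z ^ ω) (by simp [hv, hw])
    have hvF : φ z ^ (ω + 1) = φ z ^ ω * φ v * φ z ^ ω := hvF
    have hz : φ z ^ ω * φ z ^ ω = φ z ^ ω := hω.2 (φ z)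
    have hzz : (φ z ^ (ω + 1)) ^ ω = φ z ^ ω := by
      rw [pow_succ, ← pow_succ, ← pow_mul, mul_comm, pow_mul]
      exact (show IsIdempotentElem (φ z ^ ω) from hω.2 _).pow_succ_eq ω
    change φ z ^ (ω + 1) = φ z ^ ω * φ (.ofList w) * φ z ^ ω
    simp only [map_mul, map_pow, ← hvF] at h1
    rw [pow_succ, hzz] at h1
    calc φ z ^ (ω + 1) = φ z ^ ω * φ z ^ (ω + 1) := by rw [pow_succ, ← mul_assoc, hz]
      _ = (φ z ^ ω * φ z ^ ω) * φ (.ofList w) * (φ z ^ ω * φ z ^ ω) := by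
          rw [h1]; simp only [mul_assoc]
      _ = _ := by rw [hz]
  have hs : s ∈ F := by
    change s ^ (ω + 1) = s ^ ω * s * s ^ ω
    rw [← pow_succ, pow_succ, mul_assoc, ← pow_succ', pow_succ, ← mul_assoc, (hω.2 s).eq]
  exact (hst F hF).1 hs

end Necessity

/-! ### Primitive recursive and computable predicates -/

section PrimrecTools

variable {α β : Type*} [Primcodable α] [Primcodable β]

theorem primrecPred_imp {p q : α → Prop} (hp : PrimrecPred p) (hq : PrimrecPred q) :
    PrimrecPred fun a => p a → q a :=
  (hp.not.or hq).of_eq fun _ => imp_iff_not_or.symm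

theorem primrecPred_iff {p q : α → Prop} (hp : PrimrecPred p) (hq : PrimrecPred q) :
    PrimrecPred fun a => (p a ↔ q a) :=
  ((primrecPred_imp hp hq).and (primrecPred_imp hq hp)).of_eq fun _ => iff_iff_implies_and_implies.symm

theorem primrecPred_forall_mem {p : α → β → Prop} {f : α → List β}
    (hp : PrimrecPred fun x : α × β => p x.1 x.2) (hf : Primrec f) :
    PrimrecPred fun a => ∀ x ∈ f a, p a x := by
  have h : PrimrecRel fun (x : β) (a : α) => p a x := hp.comp (Primrec.snd.pair Primrec.fst)
  exact h.forall_mem_list.comp hf Primrec.id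

theorem primrecPred_exists_mem {p : α → β → Prop} {f : α → List β}
    (hp : PrimrecPred fun x : α × β => p x.1 x.2) (hf : Primrec f) :
    PrimrecPred fun a => ∃ x ∈ f a, p a x := by
  have h : PrimrecRel fun (x : β) (a : α) => p a x := hp.comp (Primrec.snd.pair Primrec.fst)
  exact h.exists_mem_list.comp hf Primrec.id

theorem primrecPred_forall_lt {p : α → ℕ → Prop} {f : α → ℕ}
    (hp : PrimrecPred fun x : α × ℕ => p x.1 x.2) (hf : Primrec f) :
    PrimrecPred fun a => ∀ x < f a, p a x :=
  (primrecPred_forall_mem hp (Primrec.list_range.comp hf)).of_eq fun a => by simp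

theorem primrecPred_mem {f : α → β} {l : α → List β} (hf : Primrec f) (hl : Primrec l) :
    PrimrecPred fun a => f a ∈ l a :=
  (primrecPred_exists_mem (p := fun a x => x = f a)
    (Primrec.eq.comp Primrec.snd (hf.comp Primrec.fst)) hl).of_eq fun a => by simp

theorem primrec_filter {p : α → β → Prop} [∀ a, DecidablePred (p a)] {f : α → List β}
    (hp : PrimrecPred fun x : α × β => p x.1 x.2) (hf : Primrec f) :
    Primrec fun a => (f a).filter fun x => decide (p a x) := by
  have h : PrimrecRel fun (x : β) (a : α) => p a x := hp.comp (Primrec.snd.pair Primrec.fst)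
  let _ : DecidableRel fun (x : β) (a : α) => p a x := fun x a => inferInstanceAs (Decidable (p a x))
  exact h.listFilter.comp hf Primrec.id

open scoped Classical in
theorem primrec_findIdx {p : α → β → Prop} {f : α → List β}
    (hp : PrimrecPred fun x : α × β => p x.1 x.2) (hf : Primrec f) :
    Primrec fun a => (f a).findIdx fun x => decide (p a x) :=
  Primrec.list_findIdx hf (PrimrecPred.decide hp)

theorem primrec_two_pow : Primrec fun n : ℕ => 2 ^ n :=
  (Primrec.nat_iterate (f := fun n : ℕ => n) (g := fun _ => 1) (h := fun _ x => 2 * x) Primrec.id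
    (Primrec.const 1) (Primrec.nat_double.comp Primrec.snd).to₂).of_eq fun n => by
      simp [mul_left_iterate]

theorem primrecPred_testBit {f g : α → ℕ} (hf : Primrec f) (hg : Primrec g) :
    PrimrecPred fun a => (f a).testBit (g a) = true :=
  (Primrec.eq.comp (Primrec.nat_mod.comp (Primrec.nat_div.comp hf (primrec_two_pow.comp hg))
    (Primrec.const 2)) (Primrec.const 1)).of_eq fun a => by
      simp [Nat.testBit_eq_decide_div_mod_eq]

theorem exists_testBit (n : ℕ) (p : ℕ → Prop) :
    ∃ k < 2 ^ n, ∀ i < n, (k.testBit i = true ↔ p i) := by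
  classical
  exact ⟨Nat.ofBits fun i : Fin n => decide (p i), Nat.ofBits_lt_two_pow _, fun i hi => by simp [hi]⟩

/-- The test for `C` is only assumed computable, so the primitive recursive quantifiers do not
suffice. -/
theorem computable_forall_lt {p : α → ℕ → Bool} {f : α → ℕ} (hp : Computable₂ p)
    (hf : Computable f) :
    ∃ b : α → Bool, Computable b ∧ ∀ a, b a = true ↔ ∀ x < f a, p a x = true := by
  refine ⟨fun a => Nat.rec true (fun k b => b && p a k) (f a),
    Computable.nat_rec hf (Computable.const true) (h := fun a kb => kb.2 && p a kb.1) ?_, ?_⟩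
  · exact (Primrec.and.to_comp.comp (Computable.snd.comp Computable.snd)
      (hp.comp Computable.fst (Computable.fst.comp Computable.snd))).to₂
  · intro a
    change (Nat.rec true (fun k b => b && p a k) (f a) : Bool) = true ↔ _
    generalize f a = n
    induction n with
    | zero => simp
    | succ n ih => rw [Nat.forall_lt_succ_right, ← ih, Bool.and_eq_true]

end PrimrecTools

/-! ### Computations with codes -/

namespace MorphismCode

/-- The default value `0` plays no role for numbers of elements when `c` presents a morphism. -/
def mul (c : MorphismCode) (i j : ℕ) : ℕ := c.table.getD (i * c.size + j) 0

def letter (c : MorphismCode) (e : ℕ) : ℕ := c.letters.getD e 0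

/-- The set of numbers given by the binary digits of `k` contains the identity and is closed under
right multiplication by the letters numbered in `E`. -/
def IsClosedMask (E : List ℕ) (c : MorphismCode) (k : ℕ) : Prop :=
  k.testBit c.one = true ∧
    ∀ i < c.size, k.testBit i = true → ∀ e ∈ E, k.testBit (c.mul i (c.letter e)) = true

/-- `x` is the number of the image of some word. -/
def IsReachable (E : List ℕ) (c : MorphismCode) (x : ℕ) : Prop :=
  ∀ k < 2 ^ c.size, c.IsClosedMask E k → k.testBit x = true

theorem primrec_size : Primrec size := Primrec.fst

theorem primrec_one : Primrec one := Primrec.fst.comp Primrec.snd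

theorem primrec_table : Primrec table := Primrec.fst.comp (Primrec.snd.comp Primrec.snd)

theorem primrec_letters : Primrec letters := Primrec.snd.comp (Primrec.snd.comp Primrec.snd)

variable {α : Type*} [Primcodable α] {f : α → MorphismCode} {g h : α → ℕ}

theorem primrec_mul (hf : Primrec f) (hg : Primrec g) (hh : Primrec h) :
    Primrec fun a => (f a).mul (g a) (h a) :=
  (Primrec.list_getD 0).comp (primrec_table.comp hf)
    (Primrec.nat_add.comp (Primrec.nat_mul.comp hg (primrec_size.comp hf)) hh)

theorem primrec_letter (hf : Primrec f) (hg : Primrec g) :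
    Primrec fun a => (f a).letter (g a) :=
  (Primrec.list_getD 0).comp (primrec_letters.comp hf) hg

theorem primrecPred_isClosedMask (E : List ℕ) (hf : Primrec f) (hg : Primrec g) :
    PrimrecPred fun a => (f a).IsClosedMask E (g a) := by
  refine (primrecPred_testBit hg (primrec_one.comp hf)).and
    (primrecPred_forall_lt (p := fun a i => (g a).testBit i = true → ∀ e ∈ E,
      (g a).testBit ((f a).mul i ((f a).letter e)) = true) ?_ (primrec_size.comp hf))
  refine primrecPred_imp (primrecPred_testBit (hg.comp Primrec.fst) Primrec.snd)
    (primrecPred_forall_mem (p := fun (a : α × ℕ) e =>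
      (g a.1).testBit ((f a.1).mul a.2 ((f a.1).letter e)) = true) ?_ (Primrec.const E))
  have h1 : Primrec fun x : (α × ℕ) × ℕ => x.1.1 := Primrec.fst.comp Primrec.fst
  exact primrecPred_testBit (hg.comp h1)
    (primrec_mul (hf.comp h1) (Primrec.snd.comp Primrec.fst)
      (primrec_letter (hf.comp h1) Primrec.snd))

theorem primrecPred_isReachable (E : List ℕ) (hf : Primrec f) (hg : Primrec g) :
    PrimrecPred fun a => (f a).IsReachable E (g a) :=
  primrecPred_forall_lt (p := fun a k => (f a).IsClosedMask E k → k.testBit (g a) = true)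
    (primrecPred_imp (primrecPred_isClosedMask E (hf.comp Primrec.fst) Primrec.snd)
      (primrecPred_testBit Primrec.snd (hg.comp Primrec.fst)))
    (primrec_two_pow.comp (primrec_size.comp hf))

end MorphismCode

namespace RegularCode

open scoped Classical

/-- `i` and `j` are numbers of syntactically equivalent elements. -/
def SynEquiv (E : List ℕ) (d : RegularCode) (i j : ℕ) : Prop :=
  ∀ x < d.1.size, d.1.IsReachable E x → ∀ y < d.1.size, d.1.IsReachable E y →
    (d.1.mul (d.1.mul x i) y ∈ d.2 ↔ d.1.mul (d.1.mul x j) y ∈ d.2)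

/-- `i` is the least number of an element in its syntactic class. -/
def IsRepresentative (E : List ℕ) (d : RegularCode) (i : ℕ) : Prop :=
  d.1.IsReachable E i ∧ ∀ j < i, d.1.IsReachable E j → ¬ d.SynEquiv E i j

noncomputable def representatives (E : List ℕ) (d : RegularCode) : List ℕ :=
  (List.range d.1.size).filter fun i => decide (d.IsRepresentative E i)

/-- The position of the representative of `i`. -/
noncomputable def index (E : List ℕ) (d : RegularCode) (i : ℕ) : ℕ :=
  (d.representatives E).findIdx fun j => decide (d.SynEquiv E i j)

/-- The `k`-th representative. -/
noncomputable def rep (E : List ℕ) (d : RegularCode) (k : ℕ) : ℕ :=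
  (d.representatives E).getD k 0

noncomputable def rank (E : List ℕ) (d : RegularCode) : ℕ := (d.representatives E).length

/-- The code of the syntactic morphism of the language with code `d`. -/
noncomputable def syntactic (E : List ℕ) (d : RegularCode) : RegularCode :=
  ((d.rank E, d.index E d.1.one,
    (List.range (d.rank E * d.rank E)).map fun t =>
      d.index E (d.1.mul (d.rep E (t / d.rank E)) (d.rep E (t % d.rank E))),
    d.1.letters.map (d.index E)),
   (List.range (d.rank E)).filter fun k => decide (d.rep E k ∈ d.2))

section Primrec

variable (E : List ℕ) {α : Type*} [Primcodable α] {f : α → RegularCode} {g h : α → ℕ}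

theorem primrecPred_synEquiv (hf : Primrec f) (hg : Primrec g) (hh : Primrec h) :
    PrimrecPred fun a => (f a).SynEquiv E (g a) (h a) := by
  have hsize : Primrec fun a => (f a).1.size :=
    MorphismCode.primrec_size.comp (Primrec.fst.comp hf)
  refine primrecPred_forall_lt (p := fun a x => (f a).1.IsReachable E x →
    ∀ y < (f a).1.size, (f a).1.IsReachable E y →
    ((f a).1.mul ((f a).1.mul x (g a)) y ∈ (f a).2 ↔
      (f a).1.mul ((f a).1.mul x (h a)) y ∈ (f a).2)) ?_ hsize
  refine primrecPred_imp (MorphismCode.primrecPred_isReachable E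
    (Primrec.fst.comp (hf.comp Primrec.fst)) Primrec.snd) ?_
  refine primrecPred_forall_lt (p := fun (a : α × ℕ) y => (f a.1).1.IsReachable E y →
    ((f a.1).1.mul ((f a.1).1.mul a.2 (g a.1)) y ∈ (f a.1).2 ↔
      (f a.1).1.mul ((f a.1).1.mul a.2 (h a.1)) y ∈ (f a.1).2)) ?_ (hsize.comp Primrec.fst)
  have h1 : Primrec fun x : (α × ℕ) × ℕ => x.1.1 := Primrec.fst.comp Primrec.fst
  have hc : Primrec fun x : (α × ℕ) × ℕ => (f x.1.1).1 := Primrec.fst.comp (hf.comp h1)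
  have hF : Primrec fun x : (α × ℕ) × ℕ => (f x.1.1).2 := Primrec.snd.comp (hf.comp h1)
  have hx : Primrec fun x : (α × ℕ) × ℕ => x.1.2 := Primrec.snd.comp Primrec.fst
  refine primrecPred_imp (MorphismCode.primrecPred_isReachable E hc Primrec.snd)
    (primrecPred_iff (primrecPred_mem ?_ hF) (primrecPred_mem ?_ hF))
  · exact MorphismCode.primrec_mul hc (MorphismCode.primrec_mul hc hx (hg.comp h1)) Primrec.snd
  · exact MorphismCode.primrec_mul hc (MorphismCode.primrec_mul hc hx (hh.comp h1)) Primrec.snd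

theorem primrecPred_isRepresentative (hf : Primrec f) (hg : Primrec g) :
    PrimrecPred fun a => (f a).IsRepresentative E (g a) := by
  have h1 : Primrec fun x : α × ℕ => f x.1 := hf.comp Primrec.fst
  refine (MorphismCode.primrecPred_isReachable E (Primrec.fst.comp hf) hg).and
    (primrecPred_forall_lt (p := fun a j => (f a).1.IsReachable E j →
      ¬ (f a).SynEquiv E (g a) j) ?_ hg)
  exact primrecPred_imp
    (MorphismCode.primrecPred_isReachable E (Primrec.fst.comp h1) Primrec.snd)
    (primrecPred_synEquiv E h1 (hg.comp Primrec.fst) Primrec.snd).not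

theorem primrec_representatives : Primrec (representatives E) :=
  primrec_filter (p := fun (d : RegularCode) i => d.IsRepresentative E i)
    (primrecPred_isRepresentative E Primrec.fst Primrec.snd)
    (Primrec.list_range.comp (MorphismCode.primrec_size.comp Primrec.fst))

theorem primrec_index (hf : Primrec f) (hg : Primrec g) :
    Primrec fun a => (f a).index E (g a) :=
  primrec_findIdx (p := fun a j => (f a).SynEquiv E (g a) j)
    (primrecPred_synEquiv E (hf.comp Primrec.fst) (hg.comp Primrec.fst) Primrec.snd)
    ((primrec_representatives E).comp hf)

theorem primrec_rep (hf : Primrec f) (hg : Primrec g) : Primrec fun a => (f a).rep E (g a) :=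
  (Primrec.list_getD 0).comp ((primrec_representatives E).comp hf) hg

theorem primrec_rank : Primrec (rank E) :=
  Primrec.list_length.comp (primrec_representatives E)

theorem primrec_syntactic_table : Primrec fun d : RegularCode =>
    (List.range (d.rank E * d.rank E)).map fun t =>
      d.index E (d.1.mul (d.rep E (t / d.rank E)) (d.rep E (t % d.rank E))) := by
  have h1 : Primrec fun x : RegularCode × ℕ => x.1 := Primrec.fst
  have h2 : Primrec fun x : RegularCode × ℕ => x.2 := Primrec.snd
  have hc : Primrec fun x : RegularCode × ℕ => x.1.1 := Primrec.fst.comp h1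
  have hr : Primrec fun x : RegularCode × ℕ => x.1.rank E := (primrec_rank E).comp h1
  have hm : Primrec fun x : RegularCode × ℕ =>
      x.1.1.mul (x.1.rep E (x.2 / x.1.rank E)) (x.1.rep E (x.2 % x.1.rank E)) :=
    MorphismCode.primrec_mul hc (primrec_rep E h1 (Primrec.nat_div.comp h2 hr))
      (primrec_rep E h1 (Primrec.nat_mod.comp h2 hr))
  exact Primrec.list_map (Primrec.list_range.comp
      (Primrec.nat_mul.comp (primrec_rank E) (primrec_rank E)))
      (Primrec₂.mk (primrec_index E h1 hm))

theorem primrec_syntactic_letters : Primrec fun d : RegularCode =>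
    d.1.letters.map fun i => d.index E i := by
  have hc : Primrec fun d : RegularCode => d.1 := Primrec.fst
  have hl : Primrec fun d : RegularCode => d.1.letters := MorphismCode.primrec_letters.comp hc
  have hi : Primrec fun x : RegularCode × ℕ => x.1.index E x.2 :=
    primrec_index E Primrec.fst Primrec.snd
  exact Primrec.list_map hl (Primrec₂.mk hi)

theorem primrec_syntactic_accept : Primrec fun d : RegularCode =>
    (List.range (d.rank E)).filter fun k => decide (d.rep E k ∈ d.2) := by
  have hl : Primrec fun x : RegularCode × ℕ => x.1.2 := Primrec.snd.comp Primrec.fst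
  exact primrec_filter (p := fun (d : RegularCode) k => d.rep E k ∈ d.2)
      (primrecPred_mem (primrec_rep E Primrec.fst Primrec.snd) hl)
      (Primrec.list_range.comp (primrec_rank E))

theorem primrec_syntactic : Primrec (syntactic E) := by
  have hc : Primrec fun d : RegularCode => d.1 := Primrec.fst
  have hone : Primrec fun d : RegularCode => d.index E d.1.one :=
    primrec_index E Primrec.id (MorphismCode.primrec_one.comp hc)
  exact ((primrec_rank E).pair (hone.pair ((primrec_syntactic_table E).pair
    (primrec_syntactic_letters E)))).pair (primrec_syntactic_accept E)

end Primrec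

end RegularCode

/-! ### Correctness of the computations -/

section Correctness

open scoped Classical

variable {A M : Type u} [Encodable A] [Monoid M]

/-- The list of the numbers of the letters. -/
noncomputable def letterCodes (A : Type u) [Encodable A] [Finite A] : List ℕ :=
  (Set.finite_range (Encodable.encode : A → ℕ)).toFinset.toList

theorem mem_letterCodes [Finite A] {e : ℕ} :
    e ∈ letterCodes A ↔ ∃ a : A, Encodable.encode a = e := by
  simp [letterCodes]

theorem symm_val_injective {M : Type*} {n : ℕ} (ν : Fin n ≃ M) {x y : M}
    (h : (ν.symm x : ℕ) = ν.symm y) : x = y :=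
  ν.symm.injective (Fin.ext h)

theorem exists_symm_eq {M : Type*} {n : ℕ} (ν : Fin n ≃ M) {i : ℕ} (hi : i < n) : ∃ x, i = (ν.symm x : ℕ) :=
  ⟨ν ⟨i, hi⟩, by simp⟩

theorem mem_filter_range_symm_iff {M : Type*} {n : ℕ} (ν : Fin n ≃ M) (p : ℕ → Prop) [DecidablePred p]
    (x : M) :
    (ν.symm x : ℕ) ∈ (List.range n).filter (fun i => decide (p i)) ↔ p (ν.symm x) := by
  simp

namespace MorphismCode

variable {c : MorphismCode} {α : FreeMonoid A →* M} {ν : Fin c.size ≃ M}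

theorem Presents.mul_eq (h : c.Presents α ν) (x y : M) :
    c.mul (ν.symm x) (ν.symm y) = ν.symm (x * y) := by
  have := h.table_eq (ν.symm x) (ν.symm y)
  rw [mul, List.getD_eq_getElem?_getD, this]
  simp

theorem Presents.letter_eq (h : c.Presents α ν) (a : A) :
    c.letter (Encodable.encode a) = ν.symm (α (.of a)) := by
  rw [letter, List.getD_eq_getElem?_getD, h.letters_eq a]
  rfl

/-- The image of `α` is the least set containing the identity and closed under right multiplication
by letters; its own mask is among those tested. -/
theorem Presents.isReachable_iff [Finite A] (h : c.Presents α ν) (x : M) :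
    c.IsReachable (letterCodes A) (ν.symm x) ↔ ∃ w, α w = x := by
  constructor
  · intro hx
    obtain ⟨k, hk, hkp⟩ := exists_testBit c.size fun i => ∃ w, (ν.symm (α w) : ℕ) = i
    have := (hkp _ (ν.symm x).2).1 (hx k hk ⟨?_, ?_⟩)
    · obtain ⟨w, hw⟩ := this
      exact ⟨w, symm_val_injective ν hw⟩
    · rw [h.one_eq, hkp _ (Fin.is_lt _)]
      exact ⟨1, by rw [map_one]⟩
    · intro i hi hki e he
      obtain ⟨w, rfl⟩ := (hkp i hi).1 hki
      obtain ⟨a, rfl⟩ := mem_letterCodes.1 he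
      rw [h.letter_eq, h.mul_eq, hkp _ (Fin.is_lt _)]
      exact ⟨w * .of a, by rw [map_mul]⟩
  · rintro ⟨w, rfl⟩ k hk ⟨h1, h2⟩
    obtain ⟨w, rfl⟩ := FreeMonoid.ofList.surjective w
    induction w using List.reverseRecOn with
    | nil => rwa [FreeMonoid.ofList_nil, map_one, ← h.one_eq]
    | append_singleton w a ih =>
      have := h2 _ (Fin.is_lt _) ih _ (mem_letterCodes.2 ⟨a, rfl⟩)
      rwa [h.letter_eq, h.mul_eq, ← map_mul] at this

end MorphismCode

namespace RegularCode

variable {d : RegularCode} {α : FreeMonoid A →* M} {ν : Fin d.1.size ≃ M} {L : Language A}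

theorem Presents.mem_iff' (h : d.Presents α ν L) (w : FreeMonoid A) :
    (ν.symm (α w) : ℕ) ∈ d.2 ↔ w.toList ∈ L := (h.mem_iff _).symm

theorem Presents.synEquiv_iff [Finite A] (h : d.Presents α ν L) (u v : FreeMonoid A) :
    d.SynEquiv (letterCodes A) (ν.symm (α u)) (ν.symm (α v)) ↔
      syntacticMorphism L u = syntacticMorphism L v := by
  rw [syntacticMorphism_eq_iff]
  constructor
  · intro huv x y
    have := huv _ (Fin.is_lt _) ((h.morphism.isReachable_iff _).2 ⟨x, rfl⟩) _ (Fin.is_lt _)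
      ((h.morphism.isReachable_iff _).2 ⟨y, rfl⟩)
    simpa only [h.morphism.mul_eq, ← map_mul, h.mem_iff'] using this
  · intro huv i hi hir j hj hjr
    obtain ⟨x, rfl⟩ := exists_symm_eq ν hi
    obtain ⟨y, rfl⟩ := exists_symm_eq ν hj
    obtain ⟨x, rfl⟩ := (h.morphism.isReachable_iff _).1 hir
    obtain ⟨y, rfl⟩ := (h.morphism.isReachable_iff _).1 hjr
    simpa only [h.morphism.mul_eq, ← map_mul, h.mem_iff'] using huv x y

theorem mem_representatives {E : List ℕ} {d : RegularCode} {i : ℕ} :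
    i ∈ d.representatives E ↔ i < d.1.size ∧ d.IsRepresentative E i := by
  simp [representatives]

theorem Presents.exists_word_of_mem [Finite A] (h : d.Presents α ν L) {i : ℕ}
    (hi : i ∈ d.representatives (letterCodes A)) : ∃ w, i = (ν.symm (α w) : ℕ) := by
  rw [mem_representatives] at hi
  obtain ⟨x, rfl⟩ := exists_symm_eq ν hi.1
  obtain ⟨w, rfl⟩ := (h.morphism.isReachable_iff _).1 hi.2.1
  exact ⟨w, rfl⟩

theorem Presents.eq_of_synEquiv [Finite A] (h : d.Presents α ν L) {u v : FreeMonoid A}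
    (hu : (ν.symm (α u) : ℕ) ∈ d.representatives (letterCodes A))
    (hv : (ν.symm (α v) : ℕ) ∈ d.representatives (letterCodes A))
    (huv : syntacticMorphism L u = syntacticMorphism L v) :
    (ν.symm (α u) : ℕ) = ν.symm (α v) := by
  rw [mem_representatives] at hu hv
  rcases lt_trichotomy (ν.symm (α u) : ℕ) (ν.symm (α v)) with hlt | he | hlt
  · exact (hv.2.2 _ hlt hu.2.1 ((h.synEquiv_iff _ _).2 huv.symm)).elim
  · exact he
  · exact (hu.2.2 _ hlt hv.2.1 ((h.synEquiv_iff _ _).2 huv)).elim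

/-- The least number among the images of words congruent to `w` is a representative. -/
theorem Presents.exists_representative [Finite A] (h : d.Presents α ν L) (w : FreeMonoid A) :
    ∃ v, (ν.symm (α v) : ℕ) ∈ d.representatives (letterCodes A) ∧
      syntacticMorphism L v = syntacticMorphism L w := by
  have hex : ∃ i, ∃ v, i = (ν.symm (α v) : ℕ) ∧ syntacticMorphism L v = syntacticMorphism L w :=
    ⟨_, w, rfl, rfl⟩
  obtain ⟨v, hv, hvw⟩ := Nat.find_spec hex
  refine ⟨v, mem_representatives.2 ⟨Fin.is_lt _, (h.morphism.isReachable_iff _).2 ⟨v, rfl⟩, ?_⟩,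
    hvw⟩
  intro j hj hjr hs
  obtain ⟨x, rfl⟩ := exists_symm_eq ν (hj.trans (Fin.is_lt _))
  obtain ⟨u, rfl⟩ := (h.morphism.isReachable_iff _).1 hjr
  rw [h.synEquiv_iff] at hs
  exact Nat.find_min hex (hv ▸ hj) ⟨u, rfl, hs.symm.trans hvw⟩

theorem Presents.exists_equiv [Finite A] (h : d.Presents α ν L) :
    ∃ ν' : Fin (d.rank (letterCodes A)) ≃ (syntacticCon L).Quotient,
      (∀ w, d.index (letterCodes A) (ν.symm (α w)) = ν'.symm (syntacticMorphism L w)) ∧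
      ∀ k : Fin (d.rank (letterCodes A)), ∃ w, d.rep (letterCodes A) k = ν.symm (α w) ∧ syntacticMorphism L w = ν' k := by
  set R := d.representatives (letterCodes A) with hR
  have hword : ∀ k : Fin (d.rank (letterCodes A)), ∃ w, R[(k : ℕ)]'k.2 = (ν.symm (α w) : ℕ) :=
    fun k => h.exists_word_of_mem (List.getElem_mem _)
  choose W hW using hword
  have hWmem : ∀ k, (ν.symm (α (W k)) : ℕ) ∈ R := fun k => by
    rw [← hW]; exact List.getElem_mem _
  have hnodup : R.Nodup := List.Nodup.filter _ List.nodup_range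
  have hinj : Function.Injective fun k => syntacticMorphism L (W k) := by
    intro k l hkl
    have := h.eq_of_synEquiv (hWmem k) (hWmem l) hkl
    rw [← hW, ← hW] at this
    exact Fin.ext ((hnodup.getElem_inj_iff).1 this)
  have hsurj : Function.Surjective fun k => syntacticMorphism L (W k) := by
    intro q
    obtain ⟨w, rfl⟩ := syntacticMorphism_surjective L q
    obtain ⟨v, hv, hvw⟩ := h.exists_representative w
    obtain ⟨k, hk, hkv⟩ := List.getElem_of_mem hv
    refine ⟨⟨k, hk⟩, ?_⟩
    have h1 : α (W ⟨k, hk⟩) = α v := symm_val_injective ν ((hW ⟨k, hk⟩).symm.trans hkv)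
    have h2 : d.SynEquiv (letterCodes A) (ν.symm (α (W ⟨k, hk⟩))) (ν.symm (α v)) := by
      rw [h1, h.synEquiv_iff]
    exact ((h.synEquiv_iff _ _).1 h2).trans hvw
  set ν' := Equiv.ofBijective _ ⟨hinj, hsurj⟩ with hν'
  have hν'k : ∀ k, ν' k = syntacticMorphism L (W k) := fun k => rfl
  refine ⟨ν', fun w => ?_, fun k => ⟨W k, ?_, rfl⟩⟩
  · obtain ⟨k, hk⟩ := hsurj (syntacticMorphism L w)
    have hk' : ν'.symm (syntacticMorphism L w) = k := by
      rw [Equiv.symm_apply_eq, hν'k]; exact hk.symm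
    have hkl : (k : ℕ) < (d.representatives (letterCodes A)).length := k.2
    rw [hk', index, List.findIdx_eq hkl]
    refine ⟨?_, fun j hj => ?_⟩
    · have hWk : (d.representatives (letterCodes A))[(k : ℕ)]'hkl = _ := hW k
      rw [decide_eq_true_eq, hWk, h.synEquiv_iff]
      exact hk.symm
    · have hWj : (d.representatives (letterCodes A))[j]'(hj.trans hkl) = _ :=
        hW ⟨j, hj.trans k.2⟩
      rw [decide_eq_false_iff_not, hWj, h.synEquiv_iff]
      intro he
      have := hinj (hk.trans he)
      exact hj.ne' (congrArg Fin.val this)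
  · rw [rep, ← hR, List.getD_eq_getElem _ _ k.2, hW]

theorem Presents.syntactic [Finite A] (h : d.Presents α ν L) :
    ∃ ν' : Fin (d.syntactic (letterCodes A)).1.size ≃ (syntacticCon L).Quotient,
      (d.syntactic (letterCodes A)).Presents (syntacticMorphism L) ν' L := by
  obtain ⟨ν', hindex, hrep⟩ := h.exists_equiv
  refine ⟨ν', ⟨?_, fun i j => ?_, fun a => ?_⟩, fun w => ?_⟩
  · have := hindex 1
    rw [map_one α, map_one (syntacticMorphism L), ← h.morphism.one_eq] at this
    exact this
  · obtain ⟨u, hu, hu'⟩ := hrep i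
    obtain ⟨v, hv, hv'⟩ := hrep j
    have hi : (i : ℕ) < d.rank (letterCodes A) := i.2
    have hj : (j : ℕ) < d.rank (letterCodes A) := j.2
    have hlt : (i : ℕ) * d.rank (letterCodes A) + j <
        d.rank (letterCodes A) * d.rank (letterCodes A) := by nlinarith
    have hpos : 0 < d.rank (letterCodes A) := by omega
    have hmod : ((i : ℕ) * d.rank (letterCodes A) + j) % d.rank (letterCodes A) = j := by
      rw [add_comm, Nat.add_mul_mod_self_right, Nat.mod_eq_of_lt hj]
    have hdiv : ((i : ℕ) * d.rank (letterCodes A) + j) / d.rank (letterCodes A) = i := by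
      rw [add_comm, Nat.add_mul_div_right _ _ hpos, Nat.div_eq_of_lt hj, zero_add]
    change ((List.range (d.rank (letterCodes A) * d.rank (letterCodes A))).map _)[
      (i : ℕ) * d.rank (letterCodes A) + j]? = _
    rw [List.getElem?_map, List.getElem?_range hlt, Option.map_some, hmod,
      hdiv, hu, hv, h.morphism.mul_eq, ← map_mul, hindex, map_mul, hu',
      hv']
    rfl
  · change (d.1.letters.map (d.index (letterCodes A)))[Encodable.encode a]? = _
    rw [List.getElem?_map, h.morphism.letters_eq, Option.map_some, hindex]
    rfl
  · obtain ⟨u, hu, hu'⟩ := hrep (ν'.symm (syntacticMorphism L (FreeMonoid.ofList w)))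
    rw [Equiv.apply_symm_apply] at hu'
    change _ ↔ (ν'.symm (syntacticMorphism L (FreeMonoid.ofList w)) : ℕ) ∈
      (List.range (d.rank (letterCodes A))).filter fun k => decide (d.rep (letterCodes A) k ∈ d.2)
    rw [List.mem_filter, List.mem_range, decide_eq_true_eq, hu, h.mem_iff', ← mem_syntacticImage,
      hu', mem_syntacticImage]
    exact ⟨fun hw => ⟨Fin.is_lt _, hw⟩, fun hw => hw.2⟩

end RegularCode

/-- For a fixed alphabet the list of letter codes is a constant, so its noncomputable choice does
not affect primitive recursiveness. -/
theorem syntacticMorphismComputable (A : Type u) [Finite A] [Encodable A] :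
    SyntacticMorphismComputable A :=
  ⟨RegularCode.syntactic (letterCodes A), (RegularCode.primrec_syntactic _).to_comp,
    fun _ _ _ _ _ _ h => h.syntactic⟩

/-- The list of the numbers below `c.size` given by the binary digits of `k`. -/
def MorphismCode.maskList (c : MorphismCode) (k : ℕ) : List ℕ :=
  (List.range c.size).filter fun i => decide (k.testBit i = true)

theorem MorphismCode.primrec_maskList : Primrec₂ MorphismCode.maskList :=
  primrec_filter (p := fun (x : MorphismCode × ℕ) i => x.2.testBit i = true)
    (primrecPred_testBit (Primrec.snd.comp Primrec.fst) Primrec.snd)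
    (Primrec.list_range.comp (MorphismCode.primrec_size.comp Primrec.fst))

/-- If the set with mask `k` is accepted by `f`, it contains both or none of the two numbers. -/
def maskTest (f : RegularCode → Bool) (x : MorphismCode × ℕ × ℕ) (k : ℕ) : Bool :=
  !f (x.1, x.1.maskList k) || (k.testBit x.2.1 == k.testBit x.2.2)

theorem primrec_testBit : Primrec₂ Nat.testBit :=
  (primrecPred_testBit Primrec.fst Primrec.snd).decide.of_eq fun _ => by simp

theorem computable_maskTest {f : RegularCode → Bool} (hf : Computable f) :
    Computable₂ (maskTest f) := by
  have hc : Primrec fun x : (MorphismCode × ℕ × ℕ) × ℕ => x.1.1 := Primrec.fst.comp Primrec.fst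
  have h2 : Primrec fun x : (MorphismCode × ℕ × ℕ) × ℕ => x.1.2 := Primrec.snd.comp Primrec.fst
  have hm : Primrec fun x : (MorphismCode × ℕ × ℕ) × ℕ => x.1.1.maskList x.2 :=
    MorphismCode.primrec_maskList.comp hc Primrec.snd
  have h1 : Computable fun x : (MorphismCode × ℕ × ℕ) × ℕ => f (x.1.1, x.1.1.maskList x.2) :=
    hf.comp (hc.pair hm).to_comp
  have h3 : Primrec fun x : (MorphismCode × ℕ × ℕ) × ℕ =>
      (x.2.testBit x.1.2.1 == x.2.testBit x.1.2.2) :=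
    Primrec.beq.comp (primrec_testBit.comp Primrec.snd (Primrec.fst.comp h2))
      (primrec_testBit.comp Primrec.snd (Primrec.snd.comp h2))
  exact (Primrec.or.to_comp.comp (Primrec.not.to_comp.comp h1) h3.to_comp).to₂

/-- All subsets of the monoid are enumerated as masks below `2 ^ c.size`, and the test for `C` is
run on the preimage of each. -/
theorem canonicalEquivComputable {C : Set (Language A)} (hdec : DecidableMembership C) :
    CanonicalEquivComputable C := by
  obtain ⟨f, hf, hfC⟩ := hdec
  have hsize : Primrec fun x : MorphismCode × ℕ × ℕ => x.1.size :=
    MorphismCode.primrec_size.comp Primrec.fst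
  have hpow : Primrec fun x : MorphismCode × ℕ × ℕ => 2 ^ x.1.size := primrec_two_pow.comp hsize
  obtain ⟨b, hb, hbp⟩ := computable_forall_lt (computable_maskTest hf) hpow.to_comp
  refine ⟨b, hb, fun M _ c α ν h i j => ?_⟩
  have hF : ∀ k, f (c, c.maskList k) = true ↔
      preimageLanguage α {x | k.testBit (ν.symm x) = true} ∈ C := by
    intro k
    refine hfC M (c, c.maskList k) α ν _ ⟨h, fun w => ?_⟩
    exact (mem_filter_range_symm_iff ν (fun i => k.testBit i = true) _).symm
  have hpk : ∀ k, maskTest f (c, i, j) k = true ↔ (f (c, c.maskList k) = true →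
      (k.testBit i = true ↔ k.testBit j = true)) := by
    intro k
    rw [maskTest, Bool.or_eq_true, Bool.not_eq_true', beq_iff_eq, imp_iff_not_or,
      Bool.not_eq_true]
    exact or_congr_right Bool.eq_iff_iff
  rw [hbp]
  simp only [hpk, hF]
  constructor
  · intro hall G hG
    obtain ⟨k, hk, hkG⟩ := exists_testBit c.size fun n => ∃ x ∈ G, n = (ν.symm x : ℕ)
    have hGk : ∀ x : M, k.testBit (ν.symm x) = true ↔ x ∈ G := by
      intro x
      rw [hkG _ (Fin.is_lt _)]
      exact ⟨fun ⟨y, hy, hxy⟩ => symm_val_injective ν hxy ▸ hy, fun hx => ⟨x, hx, rfl⟩⟩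
    have := hall k hk (by simpa only [hGk, Set.ofPred_mem_eq] using hG)
    rw [← hGk, ← hGk]
    simpa using this
  · intro hij k _ hk
    simpa using hij _ hk

end Correctness

/-! ### Deciding membership in the closure -/

section Decision

/-- Among the powers with exponents `0, …, n` two coincide, so the index is at most `n` and some
period between `1` and `n` divides `n !`. This is an exponent that can be computed from the size
alone. -/
theorem pow_factorial_add_self {M : Type*} [Monoid M] {n : ℕ} (ν : Fin n ≃ M) (s : M) :
    s ^ (n.factorial + n.factorial) = s ^ n.factorial := by
  have := Fintype.ofEquiv _ ν
  obtain ⟨i, j, hne, hij⟩ := Fintype.exists_ne_map_eq_of_card_lt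
    (fun i : Fin (n + 1) => s ^ (i : ℕ)) (by simp [Fintype.card_congr ν.symm])
  wlog hlt : i < j generalizing i j
  · exact this j i hne.symm hij.symm (lt_of_le_of_ne (not_lt.1 hlt) hne.symm)
  have hlt' : (i : ℕ) < j := hlt
  have hj := j.2
  obtain ⟨d, hd⟩ := Nat.exists_eq_add_of_lt hlt'
  obtain ⟨k, hk⟩ := Nat.dvd_factorial (m := d + 1) (n := n) (by omega) (by omega)
  have h1 : s ^ ((i : ℕ) + (d + 1)) = s ^ (i : ℕ) := by rw [← add_assoc, ← hd]; exact hij.symm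
  have h2 := pow_add_mul_period h1 (i := n.factorial)
    ((by omega : (i : ℕ) ≤ n).trans n.self_le_factorial) k
  rwa [mul_comm k, ← hk] at h2

/-- All exponents making `s` idempotent give the same power of `s`, so `omega` may be replaced by a
computable exponent. -/
theorem satisfiesUPolEquation_iff {A M : Type u} [Monoid M] [Finite M] {C : Set (Language A)}
    {α : FreeMonoid A →* M} {m : ℕ} (hm : 0 < m) (hp : ∀ s : M, s ^ (m + m) = s ^ m) :
    SatisfiesUPolEquation C α ↔
      ∀ s t : M, CanonicalEquiv C α s t → s ^ m * s = s ^ m * t * s ^ m := by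
  have hω := omega_spec M
  have h : ∀ s : M, s ^ omega M = s ^ m := by
    intro s
    have h1 : IsIdempotentElem (s ^ m) := by rw [IsIdempotentElem, ← pow_add, hp]
    rw [← h1.pow_eq hω.1.ne', ← (hω.2 s).pow_eq hm.ne', ← pow_mul, ← pow_mul, mul_comm]
  simp only [SatisfiesUPolEquation, pow_succ, h]

namespace MorphismCode

/-- The number of the `k`-th power of the element with number `i`. -/
def pow (c : MorphismCode) (i k : ℕ) : ℕ := (fun x => c.mul x i)^[k] c.one

/-- The elements with numbers `i` and `j` satisfy `s ^ m * s = s ^ m * t * s ^ m`, where `m` is the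
factorial of the size. -/
def equationTest (c : MorphismCode) (i j : ℕ) : Bool :=
  c.mul (c.pow i c.size.factorial) i ==
    c.mul (c.mul (c.pow i c.size.factorial) j) (c.pow i c.size.factorial)

theorem Presents.pow_eq {A M : Type u} [Encodable A] [Monoid M] {c : MorphismCode}
    {α : FreeMonoid A →* M} {ν : Fin c.size ≃ M} (h : c.Presents α ν) (x : M) (k : ℕ) :
    c.pow (ν.symm x) k = ν.symm (x ^ k) := by
  rw [pow]
  induction k with
  | zero => simpa using h.one_eq
  | succ k ih => rw [Function.iterate_succ_apply', ih, h.mul_eq, pow_succ]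

theorem Presents.equationTest_iff {A M : Type u} [Encodable A] [Monoid M] {c : MorphismCode}
    {α : FreeMonoid A →* M} {ν : Fin c.size ≃ M} (h : c.Presents α ν) (x y : M) :
    c.equationTest (ν.symm x) (ν.symm y) = true ↔
      x ^ c.size.factorial * x = x ^ c.size.factorial * y * x ^ c.size.factorial := by
  rw [equationTest, beq_iff_eq, h.pow_eq, h.mul_eq, h.mul_eq, h.mul_eq]
  exact ⟨symm_val_injective ν, congrArg fun z => (ν.symm z : ℕ)⟩

theorem primrec_factorial : Primrec Nat.factorial :=
  (Primrec.nat_rec₁ 1 (f := fun n x => (n + 1) * x)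
    (Primrec.nat_mul.comp (Primrec.succ.comp Primrec.fst) Primrec.snd).to₂).of_eq fun n => by
      induction n with
      | zero => rfl
      | succ n ih => rw [Nat.factorial_succ, ← ih]

theorem primrec_pow {α : Type*} [Primcodable α] {f : α → MorphismCode} {g h : α → ℕ}
    (hf : Primrec f) (hg : Primrec g) (hh : Primrec h) :
    Primrec fun a => (f a).pow (g a) (h a) := by
  have h1 : Primrec fun x : α × ℕ => (f x.1).mul x.2 (g x.1) :=
    primrec_mul (hf.comp Primrec.fst) Primrec.snd (hg.comp Primrec.fst)
  exact Primrec.nat_iterate hh (primrec_one.comp hf) (Primrec₂.mk h1)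

theorem primrec_equationTest {α : Type*} [Primcodable α] {f : α → MorphismCode} {g h : α → ℕ}
    (hf : Primrec f) (hg : Primrec g) (hh : Primrec h) :
    Primrec fun a => (f a).equationTest (g a) (h a) := by
  have hm : Primrec fun a => (f a).size.factorial :=
    primrec_factorial.comp (primrec_size.comp hf)
  have hp := primrec_pow hf hg hm
  exact Primrec.beq.comp (primrec_mul hf hp hg) (primrec_mul hf (primrec_mul hf hp hh) hp)

end MorphismCode

theorem exists_computable_equation {A : Type u} [Encodable A] {C : Set (Language A)}
    (hC : CanonicalEquivComputable C) :
    ∃ b : MorphismCode → Bool, Computable b ∧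
      ∀ (M : Type u) [Monoid M] (c : MorphismCode) (α : FreeMonoid A →* M) (ν : Fin c.size ≃ M),
        c.Presents α ν → (b c = true ↔ SatisfiesUPolEquation C α) := by
  obtain ⟨h, hh, hhC⟩ := hC
  let p : MorphismCode × ℕ → ℕ → Bool := fun x j => !h (x.1, x.2, j) || x.1.equationTest x.2 j
  have hp : Computable₂ p := by
    have hc : Primrec fun x : (MorphismCode × ℕ) × ℕ => x.1.1 := Primrec.fst.comp Primrec.fst
    have hi : Primrec fun x : (MorphismCode × ℕ) × ℕ => x.1.2 := Primrec.snd.comp Primrec.fst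
    have h1 : Computable fun x : (MorphismCode × ℕ) × ℕ => h (x.1.1, x.1.2, x.2) :=
      hh.comp (hc.pair (hi.pair Primrec.snd)).to_comp
    have h2 : Primrec fun x : (MorphismCode × ℕ) × ℕ => x.1.1.equationTest x.1.2 x.2 :=
      MorphismCode.primrec_equationTest hc hi Primrec.snd
    exact (Primrec.or.to_comp.comp (Primrec.not.to_comp.comp h1) h2.to_comp).to₂
  have hs : Primrec fun x : MorphismCode × ℕ => x.1.size :=
    MorphismCode.primrec_size.comp Primrec.fst
  obtain ⟨b, hb, hbp⟩ := computable_forall_lt hp hs.to_comp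
  obtain ⟨b', hb', hbp'⟩ := computable_forall_lt (p := fun c i => b (c, i)) hb.to₂
    MorphismCode.primrec_size.to_comp
  refine ⟨b', hb', fun M _ c α ν hc => ?_⟩
  have : Finite M := Finite.of_equiv _ ν
  rw [satisfiesUPolEquation_iff c.size.factorial_pos (pow_factorial_add_self ν), hbp']
  have hpk : ∀ i j, p (c, i) j = true ↔ (h (c, i, j) = true → c.equationTest i j = true) := by
    intro i j
    change (!h (c, i, j) || c.equationTest i j) = true ↔ _
    rw [Bool.or_eq_true, Bool.not_eq_true', imp_iff_not_or, Bool.not_eq_true]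
  have key : ∀ x y : M, p (c, ν.symm x) (ν.symm y) = true ↔ (CanonicalEquiv C α x y →
      x ^ c.size.factorial * x = x ^ c.size.factorial * y * x ^ c.size.factorial) := by
    intro x y
    rw [hpk, hhC M c α ν hc, hc.equationTest_iff, Equiv.apply_symm_apply, Equiv.apply_symm_apply]
  simp only [hbp]
  constructor
  · intro hall s t
    exact (key s t).1 (hall _ (Fin.is_lt _) _ (Fin.is_lt _))
  · intro hall i hi j hj
    obtain ⟨x, rfl⟩ := exists_symm_eq ν hi
    obtain ⟨y, rfl⟩ := exists_symm_eq ν hj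
    exact (key x y).2 (hall x y)

theorem mem_UPol_iff {A : Type u} [Finite A] {C : Set (Language A)} (hC : IsPrevariety C)
    {L : Language A} (hL : L.IsRegular) :
    L ∈ UPol C ↔ SatisfiesUPolEquation C (syntacticMorphism L) :=
  ⟨equation_of_mem_UPol hC hL, mem_UPol_of_equation hC hL⟩

theorem RegularCode.Presents.isRegular {A M : Type u} [Encodable A] [Monoid M] {d : RegularCode}
    {α : FreeMonoid A →* M} {ν : Fin d.1.size ≃ M} {L : Language A} (h : d.Presents α ν L) :
    L.IsRegular :=
  have : Finite M := Finite.of_equiv _ ν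
  isRegular_of_recognized α {x | (ν.symm x : ℕ) ∈ d.2} L h.mem_iff

theorem decidableMembership_UPol {A : Type u} [Finite A] [Encodable A] {C : Set (Language A)}
    (hC : IsPrevariety C) (hcan : CanonicalEquivComputable C) : DecidableMembership (UPol C) := by
  obtain ⟨b, hb, hbC⟩ := exists_computable_equation hcan
  obtain ⟨g, hg, hgL⟩ := syntacticMorphismComputable A
  refine ⟨fun d => b (g d).1, hb.comp (Computable.fst.comp hg), fun M _ d α ν L h => ?_⟩
  obtain ⟨ν', h'⟩ := hgL M d α ν L h
  rw [hbC _ _ _ ν' h'.morphism, mem_UPol_iff hC h.isRegular]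

end Decision
end UnambiguousPolynomialClosure

theorem mainTheorem5 {A : Type u} [Finite A] [Encodable A] (C : Set (Language A))
    (hC : IsPrevariety C) (hdec : DecidableMembership C) :
    DecidableMembership (UPol C) ∧
      SyntacticMorphismComputable A ∧
      CanonicalEquivComputable C ∧
      ∀ L : Language A, L.IsRegular →
        (L ∈ UPol C ↔ SatisfiesUPolEquation C (syntacticMorphism L)) :=
  have hcan := canonicalEquivComputable hdec
  ⟨decidableMembership_UPol hC hcan, syntacticMorphismComputable A, hcan,
    fun _ hL => mem_UPol_iff hC hL⟩
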